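/- A set of positions of a matrix is independent if no two of them lie in the same row or column. An \emph{exponential RAP} (random assignment problem) $P$ with parameters $k\le\min(m,n)$ is an $m\times n$ matrix whose entries are linear combinations, with nonnegative rational coefficients, of finitely many independent exponentially distributed random variables $X_1,\dots,X_p$; $E(P)$ denotes the expected value of the minimal sum of the entries in an independent set of $k$ positions. A position is \emph{standard} if its entry is a single variable $X_i$ of intensity $1$ that occurs in no other position. A \emph{zero} is a position whose coefficients all vanish. An optimal cover of the zeros is a set of rows and columns of minimal cardinality that together contain all zeros; the column-maximal one is the optimal cover that contains every column belonging to some optimal cover. A linear function $f(x)=ax+b$ with real coefficients is \emph{$k$-positive} if $f(x)>0$ for all real $x\ge k$. An \emph{RAP-sequence} is a sequence $(P_n)_{n\ge n_0}$ of exponential RAP's with common $m$ and $k$ such that: $P_n$ has $n$ columns and is given in independent exponential variables $X_{n,1},\dots,X_{n,p(n)}$; in each position in the first $n_0$ columns and for each $i$, the coefficient of $X_{n,i}$ in $P_n$ equals the coefficient of $X_{n_0,i}$ in $P_{n_0}$ (coefficients of non-existent variables being $0$); and all positions of $P_n$ beyond column $n_0$ are standard. It is \emph{well-behaved} if (i)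 for each $i$ such that the variables $X_{n,i}$ occur in the first $n_0$ columns there is a $k$-positive linear function $f_i$ such that $X_{n,i}$ has intensity $f_i(n)$ for all $n\ge n_0$; and (ii) for every $n\ge n_0$, every nonzero entry of $P_n$ in a nonstandard position lies in a column of the column-maximal optimal cover of the zeros of $P_n$. \textbf{Theorem (Rationality Theorem).} Let $(P_n)_{n\ge n_0}$ be a well-behaved RAP-sequence with parameters $m$ and $k$. Then there is a rational function $f$ in one variable with real coefficients such that 1. every complex zero of the denominator of $f$ (in lowest terms) is real and less than $k$; 2. for every $n\ge n_0$, the expectation $E(P_n)$ is finite and $E(P_n)=f(n)$. -/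

import Mathlib

open MeasureTheory ProbabilityTheory

noncomputable section

/-- A `k`-assignment in an `m × n` matrix: a set of `k` positions, no two of them in the same row
or in the same column. -/
def IsAssignment {m n : ℕ} (k : ℕ) (s : Finset (Fin m × Fin n)) : Prop :=
  s.card = k ∧ ∀ e ∈ s, ∀ e' ∈ s, e ≠ e' → e.1 ≠ e'.1 ∧ e.2 ≠ e'.2

/-- The minimal sum of the entries of a `k`-assignment. There are finitely many `k`-assignments, and
at least one if `k ≤ min m n`, so that the infimum is then a minimum. -/
def minAssignmentSum {m n : ℕ} (k : ℕ) (A : Fin m → Fin n → ℝ) : ℝ :=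
  ⨅ s : {s : Finset (Fin m × Fin n) // IsAssignment k s}, ∑ e ∈ s.1, A e.1 e.2

/-- The rows `R` and the columns `C` cover the set `Z` of matrix positions. -/
def IsCover {m n : ℕ} (Z : Set (Fin m × Fin n)) (R : Finset (Fin m)) (C : Finset (Fin n)) : Prop :=
  ∀ e ∈ Z, e.1 ∈ R ∨ e.2 ∈ C

/-- A cover with the minimal number of rows and columns. -/
def IsOptimalCover {m n : ℕ} (Z : Set (Fin m × Fin n)) (R : Finset (Fin m))
    (C : Finset (Fin n)) : Prop :=
  IsCover Z R C ∧ ∀ R' C', IsCover Z R' C' → R.card + C.card ≤ R'.card + C'.card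

/-- The column-maximal optimal cover: the optimal cover that contains every column belonging to
some optimal cover. -/
def IsColumnMaximalOptimalCover {m n : ℕ} (Z : Set (Fin m × Fin n)) (R : Finset (Fin m))
    (C : Finset (Fin n)) : Prop :=
  IsOptimalCover Z R C ∧ ∀ R' C', IsOptimalCover Z R' C' → C' ⊆ C

/-- An exponential random assignment problem on the probability space `(Ω, μ)`: a number
`k ≤ min m n` and an `m × n` matrix whose entries are linear combinations, with nonnegative rational
coefficients, of independent exponentially distributed random variables `X 0, …, X (p - 1)`. -/
structure ExponentialRAP (k m n : ℕ) {Ω : Type*} [MeasurableSpace Ω] (μ : Measure Ω) where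
  k_le_m : k ≤ m
  k_le_n : k ≤ n
  p : ℕ
  X : Fin p → Ω → ℝ
  intensity : Fin p → ℝ
  intensity_pos : ∀ l, 0 < intensity l
  hasLaw : ∀ l, HasLaw (X l) (expMeasure (intensity l)) μ
  indep : iIndepFun X μ
  coeff : Fin m → Fin n → Fin p → ℚ≥0

namespace ExponentialRAP

variable {k m n : ℕ} {Ω : Type*} [MeasurableSpace Ω] {μ : Measure Ω}

/-- The matrix of random variables. -/
def entry (P : ExponentialRAP k m n μ) (i : Fin m) (j : Fin n) (ω : Ω) : ℝ :=
  ∑ l, ((P.coeff i j l : ℚ) : ℝ) * P.X l ω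

/-- The minimal sum of an independent set of `k` matrix elements, as a random variable. -/
def cost (P : ExponentialRAP k m n μ) (ω : Ω) : ℝ :=
  minAssignmentSum k (fun i j => P.entry i j ω)

/-- `E(P)`, the expected value of the minimal sum of an independent set of `k` matrix elements. -/
def expectedCost (P : ExponentialRAP k m n μ) : ℝ :=
  ∫ ω, P.cost ω ∂μ

/-- The coefficient of the variable with index `l`, which is zero if there is no such variable. -/
def coeffAt (P : ExponentialRAP k m n μ) (i : Fin m) (j : Fin n) (l : ℕ) : ℚ≥0 :=
  if h : l < P.p then P.coeff i j ⟨l, h⟩ else 0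

/-- The set of positions of the zero entries. -/
def zeros (P : ExponentialRAP k m n μ) : Set (Fin m × Fin n) :=
  {e | ∀ l, P.coeff e.1 e.2 l = 0}

/-- The position `(i, j)` is standard: its entry is a single variable of intensity 1 (with
coefficient 1), and this variable occurs in no other position. -/
def IsStandardPosition (P : ExponentialRAP k m n μ) (i : Fin m) (j : Fin n) : Prop :=
  ∃ l, P.intensity l = 1 ∧ P.coeff i j l = 1 ∧ (∀ l', l' ≠ l → P.coeff i j l' = 0) ∧
    ∀ i' j', P.coeff i' j' l ≠ 0 → i' = i ∧ j' = j

end ExponentialRAP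

/-- A linear function `x ↦ a x + b` is `k`-positive if it is positive for all `x ≥ k`. -/
def IsKPositive (k : ℕ) (f : ℝ → ℝ) : Prop :=
  (∃ a b : ℝ, ∀ x, f x = a * x + b) ∧ ∀ x : ℝ, (k : ℝ) ≤ x → 0 < f x

/-- An RAP-sequence `P n`, `n ≥ n₀`, of exponential RAP's with the same `k` and `m`, where `P n` has
`n` columns. -/
structure RAPSequence (k m n₀ : ℕ) {Ω : ℕ → Type*} [∀ n, MeasurableSpace (Ω n)]
    (μ : ∀ n, Measure (Ω n)) where
  P : ∀ n, n₀ ≤ n → ExponentialRAP k m n (μ n)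
  coeff_eq : ∀ n (h : n₀ ≤ n) (i : Fin m) (j : Fin n₀) (l : ℕ),
    (P n h).coeffAt i (Fin.castLE h j) l = (P n₀ le_rfl).coeffAt i j l
  standard_beyond : ∀ n (h : n₀ ≤ n) (i : Fin m) (j : Fin n), n₀ ≤ (j : ℕ) →
    (P n h).IsStandardPosition i j

/-- A well-behaved RAP-sequence. -/
structure RAPSequence.WellBehaved {k m n₀ : ℕ} {Ω : ℕ → Type*} [∀ n, MeasurableSpace (Ω n)]
    {μ : ∀ n, Measure (Ω n)} (S : RAPSequence k m n₀ μ) : Prop where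
  /-- The intensity of a variable that occurs in the first `n₀` columns is a `k`-positive linear
  function of `n`. -/
  intensity_linear : ∀ l : ℕ, (∃ i j, (S.P n₀ le_rfl).coeffAt i j l ≠ 0) →
    ∃ f : ℝ → ℝ, IsKPositive k f ∧
      ∀ n (h : n₀ ≤ n) (hl : l < (S.P n h).p), (S.P n h).intensity ⟨l, hl⟩ = f n
  /-- The column of a nonzero nonstandard entry belongs to the column-maximal optimal cover of the
  zeros. -/
  nonstandard_covered : ∀ n (h : n₀ ≤ n) (i : Fin m) (j : Fin n),
    (i, j) ∉ (S.P n h).zeros → ¬ (S.P n h).IsStandardPosition i j →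
      ∃ R C, IsColumnMaximalOptimalCover (S.P n h).zeros R C ∧ j ∈ C

end

/-! The Hungarian algorithm is run symbolically on the matrix of linear forms, simultaneously for
all `n`. A `MatchingState` holds a set `I` of rows matched by `σ` to independent zeros and a set `R
⊆ I` of rows reached by alternating paths. The rows of `R` and the columns `σ(I \ R)` form a partial
cover with `|I|` lines. If a nonnegative amount `t` is subtracted from the uncovered entries and
added to the doubly covered ones, and the entries remain nonnegative, the minimal sum drops by
exactly `t (k - |I|)` (`minAssignmentSum_eq_add_mul`).

For `t` one takes the minimum of the standard variables in the uncovered positions of unmatched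
columns, together with one suitably scaled variable `v` from the uncovered entries in the columns
`σ(R)`. A minimum of independent exponentials is exponential with the sum of the rates, and by
memorylessness the excesses of the others over it are again independent exponentials with their old
rates (`lintegral_expPi_split_min`). Hence `E` is a weighted average of expectations of simpler
problems plus `(k - |I|) / rate`. The rate is `(m - |R|)(n - |I|) + f_v(n)`, linear in `n` and
positive for `n ≥ k` because `|I| < k`. All denominators are such functions, so their zeros are real
and less than `k`. The standard columns beyond `n₀` are interchangeable; together they contribute `n
- n₀` times one term.

If the minimum is a standard variable, its position becomes a zero, and either a new row is reached
(`reach`) or the matching grows (`augment`). If the minimum is `v`, some uncovered entry must lose a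
variable. For this, one of the uncovered entries in `σ(R)` has to be coefficientwise least. That is
arranged beforehand: two incomparable entries are made to differ in fewer variables by scaling two
variables and conditioning on which is smaller (`isRationalSeq_of_comparable_insert`). The recursion
ends when `|I| = k`, where the cost is zero.

Well-behavedness supplies the initial state: by Hall's theorem the columns of an optimal cover are
matched by independent zeros, and outside the columns of the column-maximal optimal cover every
entry is zero or standard. -/

open scoped ENNReal

/-! ### One and two exponential variables: memorylessness, scaling, mean. -/

/-- The exponential distribution of rate `r`, extended to `r ≤ 0` by a Dirac mass. -/
noncomputable def expLaw (r : ℝ) : Measure ℝ :=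
  -- The value for `r ≤ 0` makes this a probability measure for every real `r`, so product measures
  -- need no positivity hypothesis.
  open Classical in if 0 < r then expMeasure r else Measure.dirac 0

theorem expLaw_of_pos {r : ℝ} (hr : 0 < r) : expLaw r = expMeasure r := by
  simp [expLaw, hr]

instance isProbabilityMeasure_expLaw (r : ℝ) : IsProbabilityMeasure (expLaw r) := by
  unfold expLaw
  split_ifs with h
  · exact isProbabilityMeasure_expMeasure h
  · infer_instance

theorem lintegral_expLaw {r : ℝ} (hr : 0 < r) {h : ℝ → ℝ≥0∞} (hh : Measurable h) :
    ∫⁻ x, h x ∂expLaw r = ∫⁻ x, exponentialPDF r x * h x := by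
  rw [expLaw_of_pos hr, expMeasure, gammaMeasure,
    lintegral_withDensity_eq_lintegral_mul _ (by unfold gammaPDF; fun_prop) hh]
  rfl

theorem measurable_exponentialPDF (r : ℝ) : Measurable (exponentialPDF r) := by
  unfold exponentialPDF; fun_prop

theorem ae_nonneg_expLaw (r : ℝ) : ∀ᵐ x ∂expLaw r, 0 ≤ x := by
  by_cases hr : 0 < r
  · rw [ae_iff, ← lintegral_indicator_one (by measurability),
      lintegral_expLaw hr (by measurability), lintegral_eq_zero_iff (by
        refine (measurable_exponentialPDF r).mul ?_; measurability)]
    refine Filter.Eventually.of_forall fun x => ?_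
    by_cases hx : 0 ≤ x
    · simp [hx]
    · simp [exponentialPDF_of_neg (not_le.1 hx)]
  · simp [expLaw, hr, ae_dirac_eq]

/-- The part of the integral over two independent exponential variables where the first one is
smaller. -/
theorem lintegral_expLaw_half {a b : ℝ} (ha : 0 < a) (hb : 0 < b) {h : ℝ → ℝ → ℝ≥0∞}
    (hh : Measurable (Function.uncurry h)) :
    ∫⁻ s, ∫⁻ t, (exponentialPDF a s * exponentialPDF b t) * (if s < t then h s t else 0) =
      ENNReal.ofReal (a / (a + b)) *
        ∫⁻ s, ∫⁻ t, h s (s + t) ∂expLaw b ∂expLaw (a + b) := by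
  have hab : 0 < a + b := by positivity
  have hm2 : Measurable (Function.uncurry fun s t => h s (s + t)) :=
    hh.comp (measurable_fst.prodMk (measurable_fst.add measurable_snd))
  have hme := measurable_exponentialPDF
  rw [lintegral_expLaw hab (by
    exact Measurable.lintegral_prod_right (ν := expLaw b) hm2), ← lintegral_const_mul _ (by
    exact (hme _).mul (Measurable.lintegral_prod_right (ν := expLaw b) hm2))]
  refine lintegral_congr fun s => ?_
  -- The inner variable is translated by `s`; what remains is the density identity `a e^(-as) · b
  -- e^(-b(s+t)) = a/(a+b) · (a+b) e^(-(a+b)s) · b e^(-bt)`.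
  rw [lintegral_expLaw hb (h := fun t => h s (s + t)) (hm2.comp measurable_prodMk_left),
    ← lintegral_const_mul _ (by exact (hme _).mul (hm2.comp measurable_prodMk_left)),
    ← lintegral_const_mul _ (by
      exact ((hme _).mul (hm2.comp measurable_prodMk_left)).const_mul _),
    ← lintegral_add_left_eq_self _ s]
  refine lintegral_congr_ae ?_
  have h0 : ∀ᵐ t : ℝ, t ≠ 0 := by simp [ae_iff]
  filter_upwards [h0] with t ht
  rcases lt_or_gt_of_ne ht with ht | ht
  · simp [exponentialPDF_of_neg ht, ht.le]
  · simp only [lt_add_iff_pos_right, ht, if_true]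
    rcases lt_or_ge s 0 with hs | hs
    · simp [exponentialPDF_of_neg hs]
    · rw [exponentialPDF_of_nonneg hs, exponentialPDF_of_nonneg hs, exponentialPDF_of_nonneg ht.le,
        exponentialPDF_of_nonneg (by positivity), ← mul_assoc, ← mul_assoc,
        ← ENNReal.ofReal_mul (by positivity), ← ENNReal.ofReal_mul (by positivity),
        ← ENNReal.ofReal_mul (by positivity)]
      congr 2
      rw [show a / (a + b) * ((a + b) * Real.exp (-((a + b) * s))) * (b * Real.exp (-(b * t))) =
        a * b * (Real.exp (-((a + b) * s)) * Real.exp (-(b * t))) by field_simp,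
        ← Real.exp_add, show a * Real.exp (-(a * s)) * (b * Real.exp (-(b * (s + t)))) =
        a * b * (Real.exp (-(a * s)) * Real.exp (-(b * (s + t)))) by ring, ← Real.exp_add]
      congr 2; ring

/-- Memorylessness: the first variable is smaller with probability `a / (a + b)`; given this, the
minimum has rate `a + b` and the excess of the second is independent of it with rate `b`. Ties form
a null set. -/
theorem lintegral_lintegral_expLaw_split {a b : ℝ} (ha : 0 < a) (hb : 0 < b) {h : ℝ → ℝ → ℝ≥0∞}
    (hh : Measurable (Function.uncurry h)) :
    ∫⁻ s, ∫⁻ t, h s t ∂expLaw b ∂expLaw a =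
      ENNReal.ofReal (a / (a + b)) * ∫⁻ s, ∫⁻ t, h s (s + t) ∂expLaw b ∂expLaw (a + b) +
      ENNReal.ofReal (b / (a + b)) * ∫⁻ s, ∫⁻ t, h (s + t) t ∂expLaw (a + b) ∂expLaw a := by
  have hme := measurable_exponentialPDF
  have hsw : Measurable (Function.uncurry fun s t => h t s) := hh.comp measurable_swap
  have e1 := lintegral_expLaw_half ha hb hh
  have e2 := lintegral_expLaw_half hb ha hsw
  have hm3 : Measurable (Function.uncurry fun s t => h (s + t) t) :=
    hh.comp ((measurable_fst.add measurable_snd).prodMk measurable_snd)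
  have e3 : ∫⁻ s, ∫⁻ t, h (s + t) t ∂expLaw (a + b) ∂expLaw a =
      ∫⁻ s, ∫⁻ t, h (s + t) s ∂expLaw a ∂expLaw (b + a) := by
    rw [lintegral_lintegral_swap hm3.aemeasurable, add_comm b a]
    simp only [add_comm]
  rw [e3, ← e1, add_comm a b, ← e2]
  have hpm : Measurable (Function.uncurry fun s t => exponentialPDF a s * exponentialPDF b t *
      (if s < t then h s t else 0)) := by
    refine (((hme a).comp measurable_fst).mul ((hme b).comp measurable_snd)).mul ?_
    exact Measurable.ite (measurableSet_lt measurable_fst measurable_snd) hh measurable_const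
  have hpm2 : Measurable (Function.uncurry fun s t => exponentialPDF b s * exponentialPDF a t *
      (if s < t then h t s else 0)) := by
    refine (((hme b).comp measurable_fst).mul ((hme a).comp measurable_snd)).mul ?_
    exact Measurable.ite (measurableSet_lt measurable_fst measurable_snd) hsw measurable_const
  rw [lintegral_lintegral_swap (f := fun s t => exponentialPDF b s * exponentialPDF a t *
      (if s < t then h t s else 0)) hpm2.aemeasurable, ← lintegral_add_left (by
    exact Measurable.lintegral_prod_right hpm),
    lintegral_expLaw ha (by exact Measurable.lintegral_prod_right (ν := expLaw b) hh)]
  refine lintegral_congr fun s => ?_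
  rw [lintegral_expLaw hb (h := fun t => h s t) (hh.comp measurable_prodMk_left),
    ← lintegral_const_mul _ (by exact (hme _).mul (hh.comp measurable_prodMk_left)),
    ← lintegral_add_left (by exact hpm.comp measurable_prodMk_left)]
  refine lintegral_congr_ae ?_
  have h0 : ∀ᵐ t : ℝ, t ≠ s := by simp [ae_iff]
  filter_upwards [h0] with t ht
  rcases lt_or_gt_of_ne ht with ht | ht
  · simp only [ht, ht.not_gt, if_true, if_false, mul_zero, zero_add]
    ring
  · simp only [ht, ht.not_gt, if_true, if_false, mul_zero, add_zero]
    ring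

/-- If `X` has rate `r` then `aX` has rate `r / a`; this allows coefficients to be normalized. -/
theorem lintegral_expLaw_scale {r a : ℝ} (hr : 0 < r) (ha : 0 < a) {h : ℝ → ℝ≥0∞}
    (hh : Measurable h) :
    ∫⁻ x, h x ∂expLaw r = ∫⁻ x, h (x / a) ∂expLaw (r / a) := by
  have hme := measurable_exponentialPDF
  rw [lintegral_expLaw hr hh, lintegral_expLaw (div_pos hr ha) (by fun_prop)]
  have e := Real.map_volume_mul_left (a := a⁻¹) (by positivity)
  have : ∫⁻ x, exponentialPDF r (a⁻¹ * x) * h (a⁻¹ * x) =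
      ENNReal.ofReal a * ∫⁻ x, exponentialPDF r x * h x := by
    rw [← lintegral_map (f := fun x => exponentialPDF r x * h x) ((hme _).mul hh) (by fun_prop), e,
      lintegral_smul_measure, inv_inv, abs_of_pos ha, smul_eq_mul]
  have h2 : ∫⁻ x, exponentialPDF r x * h x =
      ENNReal.ofReal a⁻¹ * ∫⁻ x, exponentialPDF r (a⁻¹ * x) * h (a⁻¹ * x) := by
    rw [this, ← mul_assoc, ← ENNReal.ofReal_mul (by positivity), inv_mul_cancel₀ ha.ne']
    simp
  rw [h2, ← lintegral_const_mul _ (by fun_prop)]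
  refine lintegral_congr fun x => ?_
  rw [← mul_assoc, inv_mul_eq_div]
  congr 1
  rcases lt_or_ge x 0 with hx | hx
  · rw [exponentialPDF_of_neg hx, exponentialPDF_of_neg (div_neg_of_neg_of_pos hx ha), mul_zero]
  · rw [exponentialPDF_of_nonneg hx, exponentialPDF_of_nonneg (by positivity),
      ← ENNReal.ofReal_mul (by positivity)]
    congr 1
    rw [show r / a * x = r * (x / a) by ring]; ring

theorem lintegral_ofReal_expLaw {r : ℝ} (hr : 0 < r) :
    ∫⁻ x, ENNReal.ofReal x ∂expLaw r = ENNReal.ofReal (1 / r) := by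
  rw [lintegral_expLaw hr (by fun_prop)]
  have h1 := Real.integral_rpow_mul_exp_neg_mul_Ioi (a := 2) (r := r) (by norm_num) hr
  have h2 : ∫⁻ x, exponentialPDF r x * ENNReal.ofReal x =
      ∫⁻ x in Set.Ioi (0 : ℝ), ENNReal.ofReal (r * (x ^ ((2 : ℝ) - 1) * Real.exp (-(r * x)))) := by
    rw [← lintegral_indicator measurableSet_Ioi]
    refine lintegral_congr fun x => ?_
    rcases le_or_gt x 0 with hx | hx
    · simp [ENNReal.ofReal_of_nonpos hx, hx]
    · rw [Set.indicator_of_mem (by exact hx), exponentialPDF_of_nonneg hx.le,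
        ← ENNReal.ofReal_mul (by positivity)]
      congr 1
      norm_num; ring
  rw [h2, ← ofReal_integral_eq_lintegral_ofReal, integral_const_mul, h1]
  · congr 1
    rw [Real.Gamma_two, show (2:ℝ) = ((2:ℕ):ℝ) by norm_num, Real.rpow_natCast]
    field_simp
  · refine Integrable.const_mul ?_ _
    -- Integrability follows from the value of the integral: a nonintegrable function would have
    -- integral `0`, whereas the Gamma value is positive.
    by_contra hc
    rw [integral_undef hc] at h1
    have : 0 < (1 / r) ^ (2 : ℝ) * Real.Gamma 2 := by
      have := Real.Gamma_pos_of_pos (show (0:ℝ) < 2 by norm_num); positivity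
    linarith
  · refine (ae_restrict_iff' measurableSet_Ioi).2 (Filter.Eventually.of_forall fun x hx => ?_)
    have : (0:ℝ) < x := hx
    simp only [Pi.zero_apply]; positivity

/-! ### Products of exponential laws and conditioning on the smallest variable. -/

/-- Add the coordinate `y w` to the other coordinates in `F`. -/
def addToOthers {δ : Type*} [DecidableEq δ] (F : Finset δ) (w : δ) (y : δ → ℝ) : δ → ℝ :=
  fun u => if u ∈ F ∧ u ≠ w then y u + y w else y u

theorem measurable_addToOthers {δ : Type*} [DecidableEq δ] (F : Finset δ) (w : δ) :
    Measurable (addToOthers F w) := by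
  refine measurable_pi_iff.2 fun u => ?_
  unfold addToOthers
  split_ifs <;> fun_prop

section ExpPi

variable {δ : Type*} [Fintype δ]

/-- The joint law of independent exponential variables with rates `r`. -/
noncomputable def expPi (r : δ → ℝ) : Measure (δ → ℝ) := Measure.pi fun v => expLaw (r v)

instance isProbabilityMeasure_expPi (r : δ → ℝ) : IsProbabilityMeasure (expPi r) := by
  unfold expPi; infer_instance

theorem ae_nonneg_expPi (r : δ → ℝ) : ∀ᵐ y ∂expPi r, ∀ v, 0 ≤ y v := by
  rw [ae_all_iff]
  intro v
  exact (Measure.quasiMeasurePreserving_eval (fun v => expLaw (r v)) v).ae (ae_nonneg_expLaw (r v))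

theorem lintegral_ofReal_eval_expPi (r : δ → ℝ) {v : δ} (hv : 0 < r v) :
    ∫⁻ y, ENNReal.ofReal (y v) ∂expPi r = ENNReal.ofReal (1 / r v) := by
  rw [← lintegral_ofReal_expLaw hv]
  exact (measurePreserving_eval (fun v => expLaw (r v)) v).lintegral_comp
    (f := fun x => ENNReal.ofReal x) (by fun_prop)

theorem lintegral_expPi_reindex (r : δ → ℝ) (π : Equiv.Perm δ) {g : (δ → ℝ) → ℝ≥0∞}
    (hg : Measurable g) :
    ∫⁻ y, g y ∂expPi r = ∫⁻ y, g (fun v => y (π v)) ∂expPi (fun v => r (π.symm v)) := by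
  have h := measurePreserving_piCongrLeft (fun v => expLaw (r v)) π.symm
  rw [expPi, ← h.lintegral_comp hg]
  have : (Measure.pi fun i' => expLaw (r (π.symm i'))) = expPi (fun v => r (π.symm v)) := rfl
  rw [this]
  refine lintegral_congr fun y => congrArg g (funext fun v => ?_)
  simpa using MeasurableEquiv.piCongrLeft_apply_apply (β := fun _ : δ => ℝ) π.symm y (π v)

variable [DecidableEq δ]

/-- Fubini with two chosen coordinates innermost; it transports the two-variable identity to a
product. -/
theorem lintegral_pi_pull_pair (μ : δ → Measure ℝ) [∀ v, IsProbabilityMeasure (μ v)] {v w : δ}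
    (hvw : v ≠ w) {g : (δ → ℝ) → ℝ≥0∞} (hg : Measurable g) :
    ∫⁻ y, g y ∂Measure.pi μ =
      ∫⁻ y : ({v, w}ᶜ : Finset δ) → ℝ, ∫⁻ s, ∫⁻ t, g (Function.update (Function.update
        (Function.updateFinset 0 {v, w}ᶜ y) v s) w t) ∂μ w ∂μ v
        ∂Measure.pi fun i : ({v, w}ᶜ : Finset δ) => μ i := by
  rw [lintegral_eq_lmarginal_univ (μ := μ) (0 : δ → ℝ),
    show (Finset.univ : Finset δ) = {v, w}ᶜ ∪ {v, w} by rw [Finset.union_comm, Finset.union_compl],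
    lmarginal_union μ g hg disjoint_compl_left]
  have : lmarginal μ {v, w} g =
      fun x => ∫⁻ s, ∫⁻ t, g (Function.update (Function.update x v s) w t) ∂μ w ∂μ v := by
    ext x
    rw [lmarginal_insert g hg (by simpa using hvw), lmarginal_singleton]
  rw [this]
  rfl

theorem lintegral_expPi_split_pair (r : δ → ℝ) {v w : δ} (hvw : v ≠ w) (hv : 0 < r v)
    (hw : 0 < r w) {g : (δ → ℝ) → ℝ≥0∞} (hg : Measurable g) :
    ∫⁻ y, g y ∂expPi r =
      ENNReal.ofReal (r v / (r v + r w)) *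
        ∫⁻ y, g (Function.update y w (y w + y v)) ∂expPi (Function.update r v (r v + r w)) +
      ENNReal.ofReal (r w / (r v + r w)) *
        ∫⁻ y, g (Function.update y v (y v + y w)) ∂expPi (Function.update r w (r v + r w)) := by
  have hg1 : Measurable fun y : δ → ℝ => g (Function.update y w (y w + y v)) := by
    refine hg.comp (measurable_pi_iff.2 fun u => ?_)
    by_cases h : u = w
    · subst h; simp only [Function.update_self]; fun_prop
    · simp only [Function.update_of_ne h]; fun_prop
  have hg2 : Measurable fun y : δ → ℝ => g (Function.update y v (y v + y w)) := by
    refine hg.comp (measurable_pi_iff.2 fun u => ?_)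
    by_cases h : u = v
    · subst h; simp only [Function.update_self]; fun_prop
    · simp only [Function.update_of_ne h]; fun_prop
  have hup : ∀ y : ({v, w}ᶜ : Finset δ) → ℝ, Measurable (Function.uncurry fun s t : ℝ =>
      g (Function.update (Function.update (Function.updateFinset 0 {v, w}ᶜ y) v s) w t)) := by
    intro y
    refine hg.comp (measurable_pi_iff.2 fun u => ?_)
    by_cases h : u = w
    · subst h; simp only [Function.update_self]; fun_prop
    · simp only [Function.update_of_ne h]
      by_cases h : u = v
      · subst h; simp only [Function.update_self]; fun_prop
      · simp only [Function.update_of_ne h]; fun_prop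
  have hrest : ∀ u x, u = v ∨ u = w → (fun i : ({v, w}ᶜ : Finset δ) =>
      expLaw (Function.update r u x i)) = fun i : ({v, w}ᶜ : Finset δ) => expLaw (r i) := by
    rintro u x hu
    ext1 i
    have hi := i.2
    simp only [Finset.mem_compl, Finset.mem_insert, Finset.mem_singleton, not_or] at hi
    rw [Function.update_of_ne]
    rcases hu with rfl | rfl
    exacts [hi.1, hi.2]
  unfold expPi
  rw [lintegral_pi_pull_pair _ hvw hg, lintegral_pi_pull_pair _ hvw hg1,
    lintegral_pi_pull_pair _ hvw hg2, hrest v _ (Or.inl rfl), hrest w _ (Or.inr rfl),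
    ← lintegral_const_mul' _ _ ENNReal.ofReal_ne_top,
    ← lintegral_const_mul' _ _ ENNReal.ofReal_ne_top, ← lintegral_add_left']
  · refine lintegral_congr fun y => ?_
    rw [lintegral_lintegral_expLaw_split hv hw (hup y)]
    simp only [Function.update_self, Function.update_of_ne hvw, Function.update_of_ne hvw.symm,
      Function.update_idem]
    congr 4
    · ext s; congr 1; ext t; rw [add_comm]
    · ext s; congr 1; ext t
      congr 1
      rw [Function.update_comm hvw.symm]
      simp
  · refine (Measurable.const_mul ?_ _).aemeasurable
    suffices hF : Measurable (fun p : ((({v, w}ᶜ : Finset δ) → ℝ) × ℝ) × ℝ =>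
        (fun y => g (Function.update y w (y w + y v))) (Function.update (Function.update
        (Function.updateFinset 0 {v, w}ᶜ p.1.1) v p.1.2) w p.2)) from
      (hF.lintegral_prod_right'
        (ν := expLaw (Function.update r v (r v + r w) w))).lintegral_prod_right'
        (ν := expLaw (Function.update r v (r v + r w) v))
    refine hg1.comp (measurable_pi_iff.2 fun u => ?_)
    by_cases h : u = w
    · subst h; simp only [Function.update_self]; fun_prop
    · simp only [Function.update_of_ne h]
      by_cases h : u = v
      · subst h; simp only [Function.update_self]; fun_prop
      · simp only [Function.update_of_ne h]
        exact (measurable_pi_apply u).comp ((measurable_updateFinset (X := fun _ : δ => ℝ)).comp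
          (measurable_fst.comp measurable_fst))

theorem lintegral_expPi_scale (r : δ → ℝ) {v : δ} (hv : 0 < r v) {a : ℝ} (ha : 0 < a)
    {g : (δ → ℝ) → ℝ≥0∞} (hg : Measurable g) :
    ∫⁻ y, g y ∂expPi r =
      ∫⁻ y, g (Function.update y v (y v / a)) ∂expPi (Function.update r v (r v / a)) := by
  have hg1 : Measurable fun y : δ → ℝ => g (Function.update y v (y v / a)) := by
    refine hg.comp (measurable_pi_iff.2 fun u => ?_)
    by_cases h : u = v
    · subst h; simp only [Function.update_self]; fun_prop
    · simp only [Function.update_of_ne h]; fun_prop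
  have pull : ∀ (r : δ → ℝ) {g : (δ → ℝ) → ℝ≥0∞} (_ : Measurable g),
      ∫⁻ y, g y ∂expPi r = ∫⁻ y : ({v}ᶜ : Finset δ) → ℝ, ∫⁻ s, g (Function.update
        (Function.updateFinset 0 {v}ᶜ y) v s) ∂expLaw (r v)
        ∂Measure.pi fun i : ({v}ᶜ : Finset δ) => expLaw (r i) := by
    intro r g hg
    rw [expPi, lintegral_eq_lmarginal_univ (μ := fun v => expLaw (r v)) (0 : δ → ℝ),
      show (Finset.univ : Finset δ) = {v}ᶜ ∪ {v} by simp,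
      lmarginal_union _ g hg disjoint_compl_left, lmarginal_singleton]
    rfl
  have hrest : (fun i : ({v}ᶜ : Finset δ) =>
      expLaw (Function.update r v (r v / a) i)) = fun i : ({v}ᶜ : Finset δ) => expLaw (r i) := by
    ext1 i
    have hi := i.2
    simp only [Finset.mem_compl, Finset.mem_singleton] at hi
    rw [Function.update_of_ne hi]
  rw [pull r hg, pull _ hg1, hrest]
  refine lintegral_congr fun y => ?_
  rw [lintegral_expLaw_scale hv ha (h := fun s => g (Function.update
        (Function.updateFinset 0 {v}ᶜ y) v s)) (hg.comp (measurable_update _))]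
  simp

/-- Conditioning on which one of the variables in `F` is the smallest. -/
theorem lintegral_expPi_split_min (F : Finset δ) (hF : F.Nonempty) (r : δ → ℝ)
    (hr : ∀ v, 0 < r v) {g : (δ → ℝ) → ℝ≥0∞} (hg : Measurable g) :
    ∫⁻ y, g y ∂expPi r =
      ∑ w ∈ F, ENNReal.ofReal (r w / ∑ v ∈ F, r v) *
        ∫⁻ y, g (addToOthers F w y) ∂expPi (Function.update r w (∑ v ∈ F, r v)) := by
  induction hF using Finset.Nonempty.cons_induction generalizing r g with
  | singleton a =>
    have : addToOthers {a} a = id := by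
      ext y u; simp only [addToOthers, Finset.mem_singleton]; split_ifs <;> simp_all
    simp [(hr a).ne', this]
  | cons w F hw hF ih =>
    set L := ∑ v ∈ F, r v with hL
    have hLpos : 0 < L := Finset.sum_pos (fun v _ => hr v) hF
    have hsum : ∑ v ∈ Finset.cons w F hw, r v = L + r w := by
      rw [Finset.sum_cons, add_comm]
    have hne : ∀ i ∈ F, i ≠ w := fun i hi h => hw (h ▸ hi)
    rw [Finset.sum_cons, hsum, ih r hr hg]
    -- Given that `i` is the smallest in `F`, it has rate `L` and is compared with `w`: either `i`
    -- remains the minimum, or `w` is smaller than everything in `F`.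
    have key : ∀ i ∈ F, ENNReal.ofReal (r i / L) *
        ∫⁻ y, g (addToOthers F i y) ∂expPi (Function.update r i L) =
        ENNReal.ofReal (r i / (L + r w)) * ∫⁻ y, g (addToOthers (Finset.cons w F hw) i y)
          ∂expPi (Function.update r i (L + r w)) +
        ENNReal.ofReal (r w / (L + r w)) * (ENNReal.ofReal (r i / L) *
          ∫⁻ y, g (addToOthers (Finset.cons w F hw) w (addToOthers F i y))
          ∂expPi (Function.update (Function.update r w (L + r w)) i L)) := by
      intro i hi
      have hiw := hne i hi
      rw [lintegral_expPi_split_pair (g := fun y => g (addToOthers F i y)) (Function.update r i L) hiw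
        (by simpa using hLpos) (by simpa [hiw.symm] using hr w)
        (hg.comp (measurable_addToOthers F i))]
      simp only [Function.update_self, Function.update_of_ne hiw.symm, Function.update_idem]
      rw [mul_add, ← mul_assoc, ← mul_assoc, ← mul_assoc,
        ← ENNReal.ofReal_mul (div_pos (hr i) hLpos).le,
        ← ENNReal.ofReal_mul (div_pos (hr i) hLpos).le,
        ← ENNReal.ofReal_mul (div_pos (hr w) (add_pos hLpos (hr w))).le]
      congr 2
      · congr 1; field_simp
      · refine lintegral_congr fun y => ?_
        congr 1; ext u
        simp only [addToOthers, Finset.mem_cons]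
        by_cases hu : u = w
        · subst hu; simp [hw, hiw.symm]
        · simp [hu, hiw]
      · congr 1; ring
      · rw [Function.update_comm hiw]
        refine lintegral_congr fun y => ?_
        congr 1; ext u
        simp only [addToOthers, Finset.mem_cons]
        by_cases hu : u = w
        · subst hu; simp [hw, hiw.symm]
        · by_cases hui : u = i
          · subst hui; simp [hu, hi, hw]
          · by_cases huF : u ∈ F
            · simp [hu, hui, huF, hw, add_assoc]
            · simp [hu, hui, huF]
    -- The terms in which `w` wins are still split according to the minimum of `F`; the induction
    -- hypothesis, read backwards with the rate of `w` updated, reassembles them into one term.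
    rw [Finset.sum_congr rfl key, Finset.sum_add_distrib, add_comm, ← Finset.mul_sum]
    congr 2
    have := ih (Function.update r w (L + r w)) (fun v => by
      by_cases h : v = w
      · subst h; simpa using add_pos hLpos (hr v)
      · simpa [h] using hr v)
      (hg.comp (measurable_addToOthers (Finset.cons w F hw) w))
    have hL' : ∑ v ∈ F, Function.update r w (L + r w) v = L :=
      Finset.sum_congr rfl fun v hv => by simp [hne v hv]
    simp only [hL', Function.comp] at this
    rw [this]
    exact Finset.sum_congr rfl fun i hi => by simp [hne i hi]

end ExpPi

/-! ### Assignments and the dual step of the Hungarian algorithm. -/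

section Assignment

variable {k m n : ℕ}

theorem exists_isAssignment (hm : k ≤ m) (hn : k ≤ n) :
    ∃ s : Finset (Fin m × Fin n), IsAssignment k s := by
  refine ⟨Finset.univ.image fun a : Fin k => (Fin.castLE hm a, Fin.castLE hn a), ?_, ?_⟩
  · rw [Finset.card_image_of_injective _ fun a b h => by simpa using h, Finset.card_fin]
  · simp only [Finset.mem_image, Finset.mem_univ, true_and]
    rintro _ ⟨a, rfl⟩ _ ⟨b, rfl⟩ h
    have : a ≠ b := fun e => h (by rw [e])
    simpa using this

theorem minAssignmentSum_le (A : Fin m → Fin n → ℝ) {s : Finset (Fin m × Fin n)}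
    (hs : IsAssignment k s) : minAssignmentSum k A ≤ ∑ e ∈ s, A e.1 e.2 :=
  ciInf_le (f := fun s : {s : Finset (Fin m × Fin n) // IsAssignment k s} => ∑ e ∈ s.1, A e.1 e.2)
    (Set.finite_range _).bddBelow ⟨s, hs⟩

theorem exists_minAssignmentSum_eq (hm : k ≤ m) (hn : k ≤ n) (A : Fin m → Fin n → ℝ) :
    ∃ s, IsAssignment k s ∧ minAssignmentSum k A = ∑ e ∈ s, A e.1 e.2 := by
  obtain ⟨s₀, hs₀⟩ := exists_isAssignment hm hn
  have : Nonempty {s : Finset (Fin m × Fin n) // IsAssignment k s} := ⟨⟨s₀, hs₀⟩⟩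
  obtain ⟨s, hs⟩ := exists_eq_ciInf_of_finite
    (f := fun s : {s : Finset (Fin m × Fin n) // IsAssignment k s} => ∑ e ∈ s.1, A e.1 e.2)
  exact ⟨s.1, s.2, hs.symm⟩

theorem minAssignmentSum_nonneg {A : Fin m → Fin n → ℝ} (hA : ∀ i j, 0 ≤ A i j) :
    0 ≤ minAssignmentSum k A :=
  Real.iInf_nonneg fun _ => Finset.sum_nonneg fun _ _ => hA _ _

theorem minAssignmentSum_comp_perm (A : Fin m → Fin n → ℝ) (π : Equiv.Perm (Fin n)) :
    minAssignmentSum k (fun i j => A i (π j)) = minAssignmentSum k A := by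
  have hinj : ∀ π : Equiv.Perm (Fin n), ∀ s : Finset (Fin m × Fin n), IsAssignment k s →
      IsAssignment k (s.map (Equiv.prodCongr (Equiv.refl _) π).toEmbedding) := by
    intro π s hs
    refine ⟨by rw [Finset.card_map, hs.1], ?_⟩
    simp only [Finset.mem_map]
    rintro _ ⟨a, ha, rfl⟩ _ ⟨b, hb, rfl⟩ hab
    have := hs.2 a ha b hb (fun e => hab (by rw [e]))
    simpa using this
  have hle : ∀ (B : Fin m → Fin n → ℝ) (ρ : Equiv.Perm (Fin n)),
      Nonempty {s : Finset (Fin m × Fin n) // IsAssignment k s} →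
      minAssignmentSum k B ≤ minAssignmentSum k (fun i j => B i (ρ j)) := by
    intro B ρ _
    refine le_ciInf fun s => (minAssignmentSum_le B (hinj ρ s.1 s.2)).trans ?_
    rw [Finset.sum_map]; rfl
  by_cases hne : Nonempty {s : Finset (Fin m × Fin n) // IsAssignment k s}
  · refine le_antisymm ?_ (hle A π hne)
    simpa using hle (fun i j => A i (π j)) π.symm hne
  -- Without assignments both infima are the infimum of an empty family of reals, which is `0`.
  · rw [not_nonempty_iff] at hne
    simp [minAssignmentSum, Real.iInf_of_isEmpty]

theorem measurable_minAssignmentSum {α : Type*} [MeasurableSpace α]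
    {A : α → Fin m → Fin n → ℝ} (hA : ∀ i j, Measurable fun y => A y i j) :
    Measurable fun y => minAssignmentSum k (A y) :=
  Measurable.iInf fun _ => Finset.measurable_sum _ fun e _ => hA e.1 e.2

theorem minAssignmentSum_eq_zero {A : Fin m → Fin n → ℝ} (hA : ∀ i j, 0 ≤ A i j)
    {s : Finset (Fin m × Fin n)} {r : ℕ} (hs : IsAssignment r s) (hk : k ≤ r)
    (h0 : ∀ e ∈ s, A e.1 e.2 = 0) : minAssignmentSum k A = 0 := by
  obtain ⟨t, hts, ht⟩ := Finset.exists_subset_card_eq (hs.1.symm ▸ hk)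
  refine le_antisymm ?_ (minAssignmentSum_nonneg hA)
  refine (minAssignmentSum_le A (s := t)
    ⟨ht, fun e he e' he' => hs.2 e (hts he) e' (hts he')⟩).trans_eq ?_
  exact Finset.sum_eq_zero fun e he => h0 e (hts he)

/-- Some optimal assignment meets every row and column of a given independent set of zeros. -/
theorem exists_optimal_saturating (hm : k ≤ m) (hn : k ≤ n) {B : Fin m → Fin n → ℝ}
    (hB : ∀ i j, 0 ≤ B i j) {M : Finset (Fin m × Fin n)} {r : ℕ} (hM : IsAssignment r M)
    (hr : r ≤ k) (h0 : ∀ e ∈ M, B e.1 e.2 = 0) :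
    ∃ s, IsAssignment k s ∧ minAssignmentSum k B = ∑ e ∈ s, B e.1 e.2 ∧
      (∀ e ∈ M, ∃ e' ∈ s, e'.1 = e.1) ∧ ∀ e ∈ M, ∃ e' ∈ s, e'.2 = e.2 := by
  classical
  let opt : Finset (Finset (Fin m × Fin n)) :=
    Finset.univ.filter fun s => IsAssignment k s ∧ minAssignmentSum k B = ∑ e ∈ s, B e.1 e.2
  have hne : opt.Nonempty := by
    obtain ⟨s, hs⟩ := exists_minAssignmentSum_eq hm hn B
    exact ⟨s, by simpa [opt] using hs⟩
  -- Among the optimal assignments, one with the largest overlap with `M` is chosen; a missed row or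
  -- column of `M` would permit an exchange that increases the overlap at no cost.
  obtain ⟨s, hs, hmax⟩ := Finset.exists_max_image opt (fun s => (s ∩ M).card) hne
  obtain ⟨hsa, hsm⟩ : IsAssignment k s ∧ _ := by simpa [opt] using hs
  -- replacing an element of `s` outside `M` by an element of `M` contradicts the choice of `s`
  have swap : ∀ e ∈ M, e ∉ s → ∀ d ∈ s, d ∉ M →
      (∀ e' ∈ s, e' ≠ d → e'.1 ≠ e.1 ∧ e'.2 ≠ e.2) → False := by
    intro e heM hes d hds hdM hfree
    have hcard : (insert e (s.erase d)).card = k := by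
      rw [Finset.card_insert_of_notMem (fun h => hes (Finset.mem_of_mem_erase h)),
        Finset.card_erase_add_one hds, hsa.1]
    have hass : IsAssignment k (insert e (s.erase d)) := by
      refine ⟨hcard, ?_⟩
      intro a ha b hb hab
      rw [Finset.mem_insert, Finset.mem_erase] at ha hb
      rcases ha with rfl | ⟨had, ha⟩ <;> rcases hb with rfl | ⟨hbd, hb⟩
      · exact absurd rfl hab
      · exact ⟨(hfree b hb hbd).1.symm, (hfree b hb hbd).2.symm⟩
      · exact hfree a ha had
      · exact hsa.2 a ha b hb hab
    have hsum : ∑ e' ∈ insert e (s.erase d), B e'.1 e'.2 ≤ ∑ e' ∈ s, B e'.1 e'.2 := by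
      rw [Finset.sum_insert (fun h => hes (Finset.mem_of_mem_erase h)), h0 e heM, zero_add]
      exact Finset.sum_le_sum_of_subset_of_nonneg (Finset.erase_subset _ _) fun _ _ _ => hB _ _
    have hmem : insert e (s.erase d) ∈ opt := by
      simp only [opt, Finset.mem_filter, Finset.mem_univ, true_and]
      exact ⟨hass, le_antisymm (minAssignmentSum_le B hass) (hsum.trans_eq hsm.symm)⟩
    have hlt : (s ∩ M).card < (insert e (s.erase d) ∩ M).card := by
      refine Finset.card_lt_card ⟨?_, ?_⟩
      · intro x hx
        rw [Finset.mem_inter] at hx ⊢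
        refine ⟨Finset.mem_insert_of_mem (Finset.mem_erase.2 ⟨?_, hx.1⟩), hx.2⟩
        rintro rfl; exact hdM hx.2
      · intro h
        have := h (Finset.mem_inter.2 ⟨Finset.mem_insert_self e _, heM⟩)
        exact hes (Finset.mem_inter.1 this).1
    exact absurd (hmax _ hmem) (not_le.2 hlt)
  -- If `s ⊆ M` while missing `e`, then `k ≤ r - 1`, against `r ≤ k`.
  have outside : ∀ e ∈ M, e ∉ s → ∃ d ∈ s, d ∉ M := by
    intro e heM hes
    by_contra! hcon
    have h1 : s ⊆ M.erase e := fun d hd => Finset.mem_erase.2 ⟨fun h => hes (h ▸ hd), hcon d hd⟩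
    have := Finset.card_le_card h1
    rw [Finset.card_erase_of_mem heM, hsa.1, hM.1] at this
    have : 0 < M.card := Finset.card_pos.2 ⟨e, heM⟩
    rw [hM.1] at this
    omega
  refine ⟨s, hsa, hsm, ?_, ?_⟩
  · intro e heM
    by_contra! hrow
    have hes : e ∉ s := fun h => hrow e h rfl
    by_cases hcol : ∃ d ∈ s, d.2 = e.2
    · obtain ⟨d, hds, hd⟩ := hcol
      have hde : d ≠ e := fun h => hes (h ▸ hds)
      -- The element blocking the column of `e` cannot belong to `M`, since `M` is independent, so
      -- it may be exchanged for `e`.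
      refine swap e heM hes d hds (fun hdM => (hM.2 d hdM e heM hde).2 hd) fun e' he' hne => ?_
      exact ⟨hrow e' he', fun h => (hsa.2 e' he' d hds hne).2 (h.trans hd.symm)⟩
    · obtain ⟨d, hds, hdM⟩ := outside e heM hes
      exact swap e heM hes d hds hdM fun e' he' _ => ⟨hrow e' he', fun h => hcol ⟨e', he', h⟩⟩
  · intro e heM
    by_contra! hcol
    have hes : e ∉ s := fun h => hcol e h rfl
    by_cases hrow : ∃ d ∈ s, d.1 = e.1
    · obtain ⟨d, hds, hd⟩ := hrow
      have hde : d ≠ e := fun h => hes (h ▸ hds)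
      refine swap e heM hes d hds (fun hdM => (hM.2 d hdM e heM hde).1 hd) fun e' he' hne => ?_
      exact ⟨fun h => (hsa.2 e' he' d hds hne).1 (h.trans hd.symm), hcol e' he'⟩
    · obtain ⟨d, hds, hdM⟩ := outside e heM hes
      exact swap e heM hes d hds hdM fun e' he' _ => ⟨fun h => hrow ⟨e', he', h⟩, hcol e' he'⟩

open Classical in
/-- The effect of one dual step of the Hungarian algorithm: subtracting `t` from the uncovered
entries and adding `t` to the doubly covered ones. -/
theorem minAssignmentSum_eq_add_mul (hm : k ≤ m) (hn : k ≤ n) {A B : Fin m → Fin n → ℝ}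
    (hB : ∀ i j, 0 ≤ B i j) {t : ℝ} (ht : 0 ≤ t) {M : Finset (Fin m × Fin n)} {r : ℕ}
    (hM : IsAssignment r M) (hr : r ≤ k) (h0 : ∀ e ∈ M, B e.1 e.2 = 0)
    {R : Finset (Fin m)} {C : Finset (Fin n)} (hR : ∀ i ∈ R, ∃ e ∈ M, e.1 = i)
    (hC : ∀ j ∈ C, ∃ e ∈ M, e.2 = j) (hRC : R.card + C.card = r)
    (hA : ∀ i j, A i j =
      B i j + t * (1 - (if i ∈ R then 1 else 0) - (if j ∈ C then 1 else 0))) :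
    minAssignmentSum k A = minAssignmentSum k B + t * (k - r : ℝ) := by
  have hrows : ∀ s : Finset (Fin m × Fin n), IsAssignment k s →
      Set.InjOn Prod.fst (s : Set (Fin m × Fin n)) := fun s hs a ha b hb hab => by
    by_contra h; exact (hs.2 a ha b hb h).1 hab
  have hcols : ∀ s : Finset (Fin m × Fin n), IsAssignment k s →
      Set.InjOn Prod.snd (s : Set (Fin m × Fin n)) := fun s hs a ha b hb hab => by
    by_contra h; exact (hs.2 a ha b hb h).2 hab
  have hsum : ∀ s : Finset (Fin m × Fin n), IsAssignment k s → ∑ e ∈ s, A e.1 e.2 =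
      ∑ e ∈ s, B e.1 e.2 + t * (k - ((s.image Prod.fst ∩ R).card : ℝ)
        - ((s.image Prod.snd ∩ C).card : ℝ)) := by
    intro s hs
    have e1 : ((s.image Prod.fst ∩ R).card : ℝ) = ∑ e ∈ s, if e.1 ∈ R then (1 : ℝ) else 0 := by
      rw [← Finset.sum_image (f := fun i => if i ∈ R then (1 : ℝ) else 0) (hrows s hs)]
      simp
    have e2 : ((s.image Prod.snd ∩ C).card : ℝ) = ∑ e ∈ s, if e.2 ∈ C then (1 : ℝ) else 0 := by
      rw [← Finset.sum_image (f := fun i => if i ∈ C then (1 : ℝ) else 0) (hcols s hs)]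
      simp
    simp only [hA, Finset.sum_add_distrib, ← Finset.mul_sum, Finset.sum_sub_distrib]
    rw [← e1, ← e2, Finset.sum_const, hs.1]
    simp
  have hrR : (r : ℝ) = R.card + C.card := by exact_mod_cast hRC.symm
  -- Every assignment meets at most `|R| + |C| = r` lines of the cover, which gives one inequality;
  -- equality holds for an optimal assignment of `B` meeting every row and column of `M`.
  refine le_antisymm ?_ ?_
  · obtain ⟨s, hs, hmin, h1, h2⟩ := exists_optimal_saturating hm hn hB hM hr h0
    refine (minAssignmentSum_le A hs).trans_eq ?_
    rw [hsum s hs, hmin, Finset.inter_eq_right.2, Finset.inter_eq_right.2, hrR, sub_sub]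
    · intro j hj
      obtain ⟨e, he, rfl⟩ := hC j hj
      obtain ⟨e', he', h⟩ := h2 e he
      exact Finset.mem_image.2 ⟨e', he', h⟩
    · intro j hj
      obtain ⟨e, he, rfl⟩ := hR j hj
      obtain ⟨e', he', h⟩ := h1 e he
      exact Finset.mem_image.2 ⟨e', he', h⟩
  · obtain ⟨s, hs, hmin⟩ := exists_minAssignmentSum_eq hm hn A
    rw [hmin, hsum s hs]
    refine add_le_add (minAssignmentSum_le B hs) (mul_le_mul_of_nonneg_left ?_ ht)
    have h1 : ((s.image Prod.fst ∩ R).card : ℝ) ≤ R.card := by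
      exact_mod_cast Finset.card_le_card Finset.inter_subset_right
    have h2 : ((s.image Prod.snd ∩ C).card : ℝ) ≤ C.card := by
      exact_mod_cast Finset.card_le_card Finset.inter_subset_right
    linarith

end Assignment

/-! ### Rational functions of `n` with real poles less than `k`. -/

section RationalSequence

open Polynomial

/-- All complex zeros of `p` are real and less than `k`. -/
def RootsRealLT (k : ℕ) (p : ℝ[X]) : Prop :=
  ∀ z : ℂ, aeval z p = 0 → z.im = 0 ∧ z.re < k

theorem RootsRealLT.mul {k : ℕ} {p q : ℝ[X]} (hp : RootsRealLT k p) (hq : RootsRealLT k q) :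
    RootsRealLT k (p * q) := by
  intro z hz
  rw [map_mul, mul_eq_zero] at hz
  exact hz.elim (hp z) (hq z)

theorem RootsRealLT.eval_ne_zero {k : ℕ} {p : ℝ[X]} (hp : RootsRealLT k p) {x : ℝ}
    (hx : (k : ℝ) ≤ x) : p.eval x ≠ 0 := by
  intro h
  have : aeval (x : ℂ) p = 0 := by
    have h1 := aeval_algebraMap_apply ℂ x p
    rw [coe_aeval_eq_eval, h] at h1
    simpa using h1
  have := (hp x this).2
  simp at this
  linarith

theorem rootsRealLT_one (k : ℕ) : RootsRealLT k 1 := by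
  intro z hz; simp at hz

theorem RootsRealLT.of_dvd {k : ℕ} {p q : ℝ[X]} (hq : RootsRealLT k q) (h : p ∣ q) :
    RootsRealLT k p := by
  obtain ⟨d, rfl⟩ := h
  intro z hz
  exact hq z (by simp [hz])

/-- A nonzero slope gives a single real root, which positivity on `[k, ∞)` forces below `k`; with
zero slope the positive constant has no root. -/
theorem IsKPositive.exists_polynomial {k : ℕ} {f : ℝ → ℝ} (hf : IsKPositive k f) :
    ∃ p : ℝ[X], RootsRealLT k p ∧ ∀ x, f x = p.eval x := by
  obtain ⟨⟨a, b, hab⟩, hpos⟩ := hf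
  refine ⟨C a * X + C b, ?_, fun x => by simp [hab]⟩
  intro z hz
  simp only [map_add, map_mul, aeval_C, aeval_X, Complex.coe_algebraMap] at hz
  have hre := congrArg Complex.re hz
  have him := congrArg Complex.im hz
  simp at hre him
  have hk := hpos k le_rfl
  rw [hab] at hk
  by_cases ha : a = 0
  · subst ha; simp at hre hk; linarith
  · refine ⟨him.resolve_left ha, ?_⟩
    by_contra! hlt
    have := hpos _ hlt
    rw [hab] at this
    linarith

/-- The sequence `e n`, `n ≥ n₀`, is given by a nonnegative rational function with real poles less
than `k`. -/
def IsRationalSeq (k n₀ : ℕ) (e : ℕ → ℝ≥0∞) : Prop :=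
  ∃ p q : ℝ[X], RootsRealLT k q ∧ ∀ n, n₀ ≤ n →
    0 ≤ p.eval (n : ℝ) / q.eval (n : ℝ) ∧ e n = ENNReal.ofReal (p.eval (n : ℝ) / q.eval (n : ℝ))

variable {k n₀ : ℕ} {e e' : ℕ → ℝ≥0∞}

theorem IsRationalSeq.congr (h : IsRationalSeq k n₀ e) (he : ∀ n, n₀ ≤ n → e' n = e n) :
    IsRationalSeq k n₀ e' := by
  obtain ⟨p, q, hq, hpq⟩ := h
  exact ⟨p, q, hq, fun n hn => ⟨(hpq n hn).1, (he n hn).trans (hpq n hn).2⟩⟩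

theorem IsRationalSeq.add (hk : k ≤ n₀) (h : IsRationalSeq k n₀ e) (h' : IsRationalSeq k n₀ e') :
    IsRationalSeq k n₀ (fun n => e n + e' n) := by
  obtain ⟨p, q, hq, hpq⟩ := h
  obtain ⟨p', q', hq', hpq'⟩ := h'
  refine ⟨p * q' + p' * q, q * q', hq.mul hq', fun n hn => ?_⟩
  have hkn : (k : ℝ) ≤ n := by exact_mod_cast hk.trans hn
  have h1 := hq.eval_ne_zero hkn
  have h2 := hq'.eval_ne_zero hkn
  have : (p * q' + p' * q).eval (n : ℝ) / (q * q').eval (n : ℝ) =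
      p.eval (n : ℝ) / q.eval (n : ℝ) + p'.eval (n : ℝ) / q'.eval (n : ℝ) := by
    simp only [eval_add, eval_mul]; field_simp
  beta_reduce
  rw [this, ENNReal.ofReal_add (hpq n hn).1 (hpq' n hn).1, (hpq n hn).2, (hpq' n hn).2]
  exact ⟨add_nonneg (hpq n hn).1 (hpq' n hn).1, rfl⟩

theorem IsRationalSeq.mul (h : IsRationalSeq k n₀ e) (h' : IsRationalSeq k n₀ e') :
    IsRationalSeq k n₀ (fun n => e n * e' n) := by
  obtain ⟨p, q, hq, hpq⟩ := h
  obtain ⟨p', q', hq', hpq'⟩ := h'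
  refine ⟨p * p', q * q', hq.mul hq', fun n hn => ?_⟩
  have : (p * p').eval (n : ℝ) / (q * q').eval (n : ℝ) =
      p.eval (n : ℝ) / q.eval (n : ℝ) * (p'.eval (n : ℝ) / q'.eval (n : ℝ)) := by
    simp only [eval_mul, div_mul_div_comm]
  beta_reduce
  rw [this, ENNReal.ofReal_mul (hpq n hn).1, (hpq n hn).2, (hpq' n hn).2]
  exact ⟨mul_nonneg (hpq n hn).1 (hpq' n hn).1, rfl⟩

theorem isRationalSeq_const {x : ℝ} (hx : 0 ≤ x) :
    IsRationalSeq k n₀ (fun _ => ENNReal.ofReal x) :=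
  ⟨C x, 1, rootsRealLT_one k, fun n _ => by simp [hx]⟩

theorem IsRationalSeq.sum {ι : Type*} (hk : k ≤ n₀) (s : Finset ι) {e : ι → ℕ → ℝ≥0∞}
    (h : ∀ i ∈ s, IsRationalSeq k n₀ (e i)) : IsRationalSeq k n₀ (fun n => ∑ i ∈ s, e i n) := by
  classical
  induction s using Finset.induction_on with
  | empty => simpa using isRationalSeq_const (k := k) (n₀ := n₀) le_rfl
  | insert a s ha ih =>
    simp only [Finset.sum_insert ha]
    exact (h a (Finset.mem_insert_self _ _)).add hk
      (ih fun i hi => h i (Finset.mem_insert_of_mem hi))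

theorem IsKPositive.isRationalSeq_div {f g : ℝ → ℝ} (hk : k ≤ n₀) (hf : IsKPositive k f)
    (hg : IsKPositive k g) : IsRationalSeq k n₀ (fun n => ENNReal.ofReal (f n / g n)) := by
  obtain ⟨p, -, hp⟩ := hf.exists_polynomial
  obtain ⟨q, hq, hgq⟩ := hg.exists_polynomial
  refine ⟨p, q, hq, fun n hn => ?_⟩
  have hkn : (k : ℝ) ≤ n := by exact_mod_cast hk.trans hn
  rw [← hp, ← hgq]
  exact ⟨(div_pos (hf.2 n hkn) (hg.2 n hkn)).le, rfl⟩

/-- The factor `n - n₀` vanishes at `n = n₀`, so nothing needs to be known about `e n₀`. This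
matters because `e` will refer to a column that exists only for `n > n₀`. -/
theorem IsRationalSeq.sub_mul (h : IsRationalSeq k (n₀ + 1) e) :
    IsRationalSeq k n₀ (fun n => ((n - n₀ : ℕ) : ℝ≥0∞) * e n) := by
  obtain ⟨p, q, hq, hpq⟩ := h
  refine ⟨(X - C (n₀ : ℝ)) * p, q, hq, fun n hn => ?_⟩
  rcases hn.eq_or_lt with rfl | hlt
  · simp
  · obtain ⟨h1, h2⟩ := hpq n hlt
    have h3 : ((n - n₀ : ℕ) : ℝ) = n - n₀ := Nat.cast_sub hn
    simp only [eval_mul, eval_sub, eval_X, eval_C]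
    rw [mul_div_assoc, ← h3, h2, ENNReal.ofReal_mul (Nat.cast_nonneg _), ENNReal.ofReal_natCast]
    exact ⟨mul_nonneg (Nat.cast_nonneg _) h1, rfl⟩

theorem isKPositive_one : IsKPositive k (fun _ => 1) :=
  ⟨⟨0, 1, fun x => by simp⟩, fun _ _ => one_pos⟩

theorem IsKPositive.add {f g : ℝ → ℝ} (hf : IsKPositive k f) (hg : IsKPositive k g) :
    IsKPositive k (fun x => f x + g x) := by
  obtain ⟨⟨a, b, h⟩, hp⟩ := hf
  obtain ⟨⟨a', b', h'⟩, hp'⟩ := hg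
  exact ⟨⟨a + a', b + b', fun x => by simp only [h, h']; ring⟩, fun x hx => add_pos (hp x hx) (hp' x hx)⟩

theorem IsKPositive.div_const {f : ℝ → ℝ} (hf : IsKPositive k f) {a : ℝ} (ha : 0 < a) :
    IsKPositive k (fun x => f x / a) := by
  obtain ⟨⟨b, c, h⟩, hp⟩ := hf
  exact ⟨⟨b / a, c / a, fun x => by simp only [h]; ring⟩, fun x hx => div_pos (hp x hx) ha⟩

theorem isKPositive_mul_sub {a b : ℕ} (ha : 0 < a) (hb : b < k) :
    IsKPositive k (fun x => (a : ℝ) * (x - b)) := by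
  refine ⟨⟨a, -(a * b), fun x => by ring⟩, fun x hx => ?_⟩
  have : (b : ℝ) < k := by exact_mod_cast hb
  exact mul_pos (by exact_mod_cast ha) (by linarith)

end RationalSequence

/-! ### The mean cost of a matrix of linear forms. -/

section MeanCost

/-- Indices of random variables: `q` special ones and one for each matrix position. -/
abbrev Var (q m : ℕ) := Fin q ⊕ (Fin m × ℕ)

/-- The variables that exist in a matrix with `n` columns. -/
abbrev FinVar (q m n : ℕ) := Fin q ⊕ (Fin m × Fin n)

/-- The inclusion of the variables of a matrix with `n` columns. -/
def FinVar.emb {q m n : ℕ} : FinVar q m n → Var q m := Sum.map id (Prod.map id Fin.val)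

theorem FinVar.emb_injective {q m n : ℕ} : Function.Injective (FinVar.emb (q := q) (m := m)
    (n := n)) :=
  Function.Injective.sumMap Function.injective_id
    (Function.Injective.prodMap Function.injective_id Fin.val_injective)

/-- The variable does not belong to a position in a column beyond `n`. -/
def Var.Below {q m : ℕ} (n : ℕ) (v : Var q m) : Prop := ∀ i j, v = Sum.inr (i, j) → j < n

theorem Var.Below.mono {q m n n' : ℕ} {v : Var q m} (h : v.Below n) (hn : n ≤ n') : v.Below n' :=
  fun i j e => (h i j e).trans_le hn

theorem Var.Below.exists_emb {q m n : ℕ} {v : Var q m} (h : v.Below n) :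
    ∃ u : FinVar q m n, u.emb = v := by
  rcases v with l | ⟨i, j⟩
  · exact ⟨Sum.inl l, rfl⟩
  · exact ⟨Sum.inr (i, ⟨j, h i j rfl⟩), rfl⟩

variable {q m k n : ℕ}

/-- The matrix with entries given by the linear forms `c`, evaluated at `y`. -/
def formMatrix (n : ℕ) (c : Fin m → ℕ → Var q m → ℝ) (y : FinVar q m n → ℝ) (i : Fin m)
    (j : Fin n) : ℝ :=
  ∑ v, c i j v.emb * y v

/-- The mean of the minimal assignment sum in the `m × n` matrix whose entries are given by the
linear forms `c` in independent exponential variables with rates `f v n`. -/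
noncomputable def meanCost (k n : ℕ) (c : Fin m → ℕ → Var q m → ℝ) (f : Var q m → ℝ → ℝ) : ℝ≥0∞ :=
  ∫⁻ y, ENNReal.ofReal (minAssignmentSum k (formMatrix n c y)) ∂expPi (fun v => f v.emb n)

variable {c c' : Fin m → ℕ → Var q m → ℝ} {f f' : Var q m → ℝ → ℝ}

theorem measurable_cost : Measurable fun y : FinVar q m n → ℝ =>
    ENNReal.ofReal (minAssignmentSum k (formMatrix n c y)) := by
  refine (measurable_minAssignmentSum fun i j => ?_).ennreal_ofReal
  unfold formMatrix
  fun_prop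

theorem formMatrix_update (w : FinVar q m n) (φ : Fin m → ℕ → ℝ) (y : FinVar q m n → ℝ) (i : Fin m)
    (j : Fin n) : formMatrix n (fun i j => Function.update (c i j) w.emb (φ i j)) y i j =
      formMatrix n c y i j + (φ i j - c i j w.emb) * y w := by
  simp only [formMatrix]
  rw [← Finset.add_sum_erase _ _ (Finset.mem_univ w), ← Finset.add_sum_erase _ _ (Finset.mem_univ w),
    Function.update_self, Finset.sum_congr rfl fun v hv => by
      rw [Function.update_of_ne (fun h => Finset.ne_of_mem_erase hv (FinVar.emb_injective h))]]
  ring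

theorem formMatrix_nonneg (hc : ∀ i j v, 0 ≤ c i j v) {y : FinVar q m n → ℝ} (hy : ∀ v, 0 ≤ y v)
    (i : Fin m) (j : Fin n) : 0 ≤ formMatrix n c y i j :=
  Finset.sum_nonneg fun _ _ => mul_nonneg (hc _ _ _) (hy _)

/-- The substitution of `a X` for `X` divides both the coefficients of `X` and its rate by `a`. -/
theorem meanCost_scale {v : Var q m} (hv : v.Below n) (hf : 0 < f v n) {a : ℝ} (ha : 0 < a) :
    meanCost k n c f = meanCost k n (fun i j => Function.update (c i j) v (c i j v / a))
      (Function.update f v fun x => f v x / a) := by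
  obtain ⟨u, rfl⟩ := hv.exists_emb
  unfold meanCost
  rw [lintegral_expPi_scale (fun v : FinVar q m n => f v.emb n) (v := u) hf ha measurable_cost]
  have hr : Function.update (fun v : FinVar q m n => f v.emb n) u (f u.emb n / a) =
      fun v : FinVar q m n => Function.update f u.emb (fun x => f u.emb x / a) v.emb n := by
    ext v
    by_cases h : v = u
    · subst h; simp
    · rw [Function.update_of_ne h, Function.update_of_ne fun e => h (FinVar.emb_injective e)]
  rw [hr]
  refine lintegral_congr fun y => ?_
  congr 2
  ext i j
  rw [formMatrix_update]
  unfold formMatrix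
  rw [← Finset.add_sum_erase _ _ (Finset.mem_univ u), ← Finset.add_sum_erase _ _ (Finset.mem_univ u),
    Function.update_self, Finset.sum_congr rfl fun v hv => by
      rw [Function.update_of_ne (Finset.ne_of_mem_erase hv)]]
  ring

/-- When `w` is the smallest variable in `F`, every other `u ∈ F` is replaced by itself plus `w`.
Only the coefficient of `w` changes: it becomes the sum of the coefficients over `F`. -/
theorem meanCost_split_min (F : Finset (Var q m)) (hF : F.Nonempty) (hFn : ∀ v ∈ F, v.Below n)
    (hf : ∀ v, 0 < f v n) {φ : Fin m → ℕ → ℝ} (hφ : ∀ i j, j < n → φ i j = ∑ u ∈ F, c i j u)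
    {g : ℝ → ℝ} (hg : g n = ∑ u ∈ F, f u n) :
    meanCost k n c f = ∑ w ∈ F, ENNReal.ofReal (f w n / g n) *
      meanCost k n (fun i j => Function.update (c i j) w (φ i j)) (Function.update f w g) := by
  classical
  let G : Finset (FinVar q m n) := Finset.univ.filter fun u => u.emb ∈ F
  have hGF : G.image FinVar.emb = F := by
    ext v
    simp only [G, Finset.mem_image, Finset.mem_filter, Finset.mem_univ, true_and]
    constructor
    · rintro ⟨u, hu, rfl⟩; exact hu
    · intro hv
      obtain ⟨u, rfl⟩ := (hFn v hv).exists_emb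
      exact ⟨u, hv, rfl⟩
  have hGne : G.Nonempty := by rw [← hGF] at hF; exact Finset.image_nonempty.1 hF
  have hsum : ∀ {M : Type} [AddCommMonoid M] (h : Var q m → M),
      ∑ u ∈ F, h u = ∑ u ∈ G, h u.emb := by
    intro M _ h
    rw [← hGF, Finset.sum_image FinVar.emb_injective.injOn]
  rw [hsum, meanCost, lintegral_expPi_split_min G hGne _ (fun v => hf v.emb) measurable_cost]
  refine Finset.sum_congr rfl fun w hw => ?_
  rw [hsum] at hg
  rw [← hg]
  congr 1
  have hr : Function.update (fun v : FinVar q m n => f v.emb n) w (g n) =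
      fun v : FinVar q m n => Function.update f w.emb g v.emb n := by
    ext v
    by_cases h : v = w
    · subst h; simp
    · rw [Function.update_of_ne h, Function.update_of_ne fun e => h (FinVar.emb_injective e)]
  rw [hr, meanCost]
  refine lintegral_congr fun y => ?_
  congr 2
  ext i j
  rw [formMatrix_update, hφ i j j.2, hsum, ← Finset.add_sum_erase _ _ hw]
  unfold formMatrix addToOthers
  have : ∀ v : FinVar q m n, c i j v.emb * (if v ∈ G ∧ v ≠ w then y v + y w else y v) =
      c i j v.emb * y v + (if v ∈ G.erase w then c i j v.emb * y w else 0) := by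
    intro v
    by_cases h : v ∈ G ∧ v ≠ w
    · rw [if_pos h, if_pos (Finset.mem_erase.2 ⟨h.2, h.1⟩)]; ring
    · rw [if_neg h, if_neg (fun e => h ⟨(Finset.mem_erase.1 e).2, (Finset.mem_erase.1 e).1⟩),
        add_zero]
  simp only [this, Finset.sum_add_distrib]
  rw [Finset.sum_ite_mem, Finset.univ_inter, ← Finset.sum_mul]
  ring

/-- Column permutations that carry the position variables along leave the mean cost unchanged; used
to identify the columns beyond `n₀`. -/
theorem meanCost_perm (π : Equiv.Perm (Fin n))
    (hc : ∀ i (j : Fin n) (v : FinVar q m n),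
      c' i (π j) (FinVar.emb (Equiv.sumCongr (Equiv.refl _) (Equiv.prodCongr (Equiv.refl _) π) v)) =
        c i j v.emb)
    (hf : ∀ v : FinVar q m n,
      f' (FinVar.emb (Equiv.sumCongr (Equiv.refl _) (Equiv.prodCongr (Equiv.refl _) π) v)) n =
        f v.emb n) :
    meanCost k n c' f' = meanCost k n c f := by
  set ρ : Equiv.Perm (FinVar q m n) :=
    Equiv.sumCongr (Equiv.refl _) (Equiv.prodCongr (Equiv.refl _) π) with hρ
  unfold meanCost
  rw [lintegral_expPi_reindex _ ρ.symm measurable_cost]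
  simp only [Equiv.symm_symm, hf]
  refine lintegral_congr fun y => ?_
  rw [← minAssignmentSum_comp_perm _ π]
  congr 2
  ext i j
  unfold formMatrix
  rw [← Equiv.sum_comp ρ]
  exact Finset.sum_congr rfl fun v _ => by simp only [hc, Equiv.symm_apply_apply]

end MeanCost

/-! ### States of the algorithm, reaching rows and augmenting the matching. -/

section State

variable {q m k : ℕ}

/-- The entry `(i, j)` is the variable belonging to this position, which has rate 1 and occurs in
no other position. -/
structure IsStd (c : Fin m → ℕ → Var q m → ℝ) (f : Var q m → ℝ → ℝ) (i : Fin m) (j : ℕ) :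
    Prop where
  eq_single : c i j = Pi.single (Sum.inr (i, j)) 1
  rate : ∀ x, f (Sum.inr (i, j)) x = 1
  unique : ∀ i' j', (i', j') ≠ (i, j) → c i' j' (Sum.inr (i, j)) = 0

/-- A state of the Hungarian algorithm. The positions `(i, σ i)`, `i ∈ I`, are independent zeros,
and the columns outside `σ(R)` that are matched, together with the rows in `R`, form the current
(partial) cover. Every row in `R` has been reached by an alternating path from an unmatched
column; this is expressed by the rearranged matchings `τ` in `exists_rearrangement`. -/
structure MatchingState (k n₀ : ℕ) (c : Fin m → ℕ → Var q m → ℝ) (f : Var q m → ℝ → ℝ)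
    (I R : Finset (Fin m)) (σ : Fin m → ℕ) : Prop where
  nonneg : ∀ i j v, 0 ≤ c i j v
  kpos : ∀ v, IsKPositive k (f v)
  subset : R ⊆ I
  injOn : Set.InjOn σ I
  zero : ∀ i ∈ I, c i (σ i) = 0
  zero_or_std : ∀ i j, j ∉ I.image σ → c i j = 0 ∨ IsStd c f i j
  std_beyond : ∀ i j, n₀ ≤ j → IsStd c f i j
  -- For an uncovered column `j`, the matching `τ` leaves `j` available for another row. By the last
  -- clause, no matched column other than `j` is lost, so columns never return to the unmatched
  -- ones.
  exists_rearrangement : ∀ j, j ∉ (I \ R).image σ → ∃ τ : Fin m → ℕ, Set.InjOn τ I ∧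
    (∀ a ∈ I \ R, τ a = σ a) ∧ (∀ a ∈ I, c a (τ a) = 0) ∧ (∀ a ∈ I, τ a ≠ j) ∧
    ∀ a ∈ I, σ a = j ∨ σ a ∈ I.image τ

variable {n₀ : ℕ} {c : Fin m → ℕ → Var q m → ℝ} {f : Var q m → ℝ → ℝ} {I R : Finset (Fin m)}
  {σ : Fin m → ℕ} {i : Fin m} {j : ℕ}

theorem IsStd.ne_zero (h : IsStd c f i j) : c i j ≠ 0 := by
  rw [h.eq_single]; simp

theorem IsStd.apply_eq_zero (h : IsStd c f i j) {v : Var q m} (hv : v ≠ Sum.inr (i, j)) :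
    c i j v = 0 := by
  rw [h.eq_single, Pi.single_eq_of_ne hv]

theorem IsStd.update (h : IsStd c f i j) {w : Var q m} (hw : w ≠ Sum.inr (i, j))
    {φ : Fin m → ℕ → ℝ} (hφ : φ i j = 0) (g : ℝ → ℝ) :
    IsStd (fun i j => Function.update (c i j) w (φ i j)) (Function.update f w g) i j where
  eq_single := by
    ext v
    by_cases hv : v = w
    · subst hv; rw [Function.update_self, hφ, Pi.single_eq_of_ne hw]
    · rw [Function.update_of_ne hv, h.eq_single]
  rate x := by rw [Function.update_of_ne hw.symm, h.rate]
  unique i' j' hne := by rw [Function.update_of_ne hw.symm, h.unique i' j' hne]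

namespace MatchingState

theorem matched_lt (S : MatchingState k n₀ c f I R σ) {i : Fin m} (hi : i ∈ I) : σ i < n₀ := by
  by_contra! h
  exact (S.std_beyond i _ h).ne_zero (S.zero i hi)

theorem lt_of_mem_image (S : MatchingState k n₀ c f I R σ) (h : j ∈ I.image σ) : j < n₀ := by
  obtain ⟨i, hi, rfl⟩ := Finset.mem_image.1 h
  exact S.matched_lt hi

theorem notMem_image_of_le (S : MatchingState k n₀ c f I R σ) (h : n₀ ≤ j) : j ∉ I.image σ :=
  fun hj => absurd (S.lt_of_mem_image hj) (not_lt.2 h)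

/-- The variable does not belong to a standard position in an unmatched column. -/
def Free (c : Fin m → ℕ → Var q m → ℝ) (f : Var q m → ℝ → ℝ) (I : Finset (Fin m))
    (σ : Fin m → ℕ) (v : Var q m) : Prop :=
  ∀ i j, j ∉ I.image σ → IsStd c f i j → v ≠ Sum.inr (i, j)

/-- A standard variable in an unmatched column occurs nowhere else, so any variable seen in a
matched column may be rescaled or merged. -/
theorem free_of_ne_zero (hj : j ∈ I.image σ) {v : Var q m} (hv : c i j v ≠ 0) :
    Free c f I σ v := by
  rintro i' j' hj' hstd rfl
  refine hv (hstd.unique i j fun e => hj' ?_)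
  rw [Prod.mk.injEq] at e
  exact e.2 ▸ hj

theorem Free.below (S : MatchingState k n₀ c f I R σ) {v : Var q m} (hv : Free c f I σ v) :
    v.Below n₀ := by
  intro i j e
  by_contra! h
  exact hv i j (S.notMem_image_of_le h) (S.std_beyond i j h) e

/-- The common invariance behind steps, scalings and mergings. Doubly covered zeros may be destroyed
because neither `σ` nor any rearrangement `τ` uses them: `τ` is injective and agrees with `σ` on `I
\ R`, hence maps no row of `R` into `σ(I \ R)`. The threshold rises to `n₁` if the changed variable
belongs to a column beyond `n₀`. -/
theorem update (S : MatchingState k n₀ c f I R σ) {n₁ : ℕ} (hn : n₀ ≤ n₁) {w : Var q m}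
    (hw : w.Below n₁) {φ : Fin m → ℕ → ℝ} {g : ℝ → ℝ} (hφ : ∀ i j, 0 ≤ φ i j)
    (hg : IsKPositive k g)
    (hz : ∀ i j, c i j = 0 → ¬ (i ∈ R ∧ j ∈ (I \ R).image σ) → φ i j = 0)
    (hstd : ∀ i j, j ∉ I.image σ → IsStd c f i j → φ i j = 0) :
    MatchingState k n₁ (fun i j => Function.update (c i j) w (φ i j)) (Function.update f w g)
      I R σ where
  nonneg i j v := by
    by_cases hv : v = w
    · subst hv; simpa using hφ i j
    · simpa [hv] using S.nonneg i j v
  kpos v := by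
    by_cases hv : v = w
    · subst hv; simpa using hg
    · simpa [hv] using S.kpos v
  subset := S.subset
  injOn := S.injOn
  zero i hi := by
    rw [S.zero i hi, hz i _ (S.zero i hi)]
    · exact Function.update_eq_self w (0 : Var q m → ℝ)
    · rintro ⟨hiR, hmem⟩
      obtain ⟨a, ha, hai⟩ := Finset.mem_image.1 hmem
      rw [Finset.mem_sdiff] at ha
      exact ha.2 (S.injOn ha.1 hi hai ▸ hiR)
  zero_or_std i j hj := by
    rcases S.zero_or_std i j hj with h | h
    · left
      rw [h, hz i j h]
      · exact Function.update_eq_self w (0 : Var q m → ℝ)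
      · rintro ⟨-, hmem⟩
        exact hj (Finset.image_subset_image Finset.sdiff_subset hmem)
    -- If the updated variable is the one belonging to this standard position, its coefficient
    -- becomes `0` and the position becomes a zero.
    · by_cases hwe : w = Sum.inr (i, j)
      · left
        ext v
        by_cases hv : v = w
        · subst hv; simpa using hstd i j hj h
        · simpa [hv] using h.apply_eq_zero (hwe ▸ hv)
      · exact Or.inr (h.update hwe (hstd i j hj h) g)
  std_beyond i j hj := by
    have h := S.std_beyond i j (hn.trans hj)
    refine h.update (fun e => absurd (hw i j e) (not_lt.2 hj)) (hstd i j ?_ h) g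
    exact S.notMem_image_of_le (hn.trans hj)
  exists_rearrangement j hj := by
    obtain ⟨τ, hinj, heq, hzero, hne, hcov⟩ := S.exists_rearrangement j hj
    refine ⟨τ, hinj, heq, fun a ha => ?_, hne, hcov⟩
    rw [hzero a ha, hz a _ (hzero a ha)]
    · exact Function.update_eq_self w (0 : Var q m → ℝ)
    · rintro ⟨haR, hmem⟩
      obtain ⟨b, hb, hba⟩ := Finset.mem_image.1 hmem
      rw [← heq b hb] at hba
      rw [Finset.mem_sdiff] at hb
      exact hb.2 (hinj hb.1 ha hba ▸ haR)

/-- Reaching a new matched row. -/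
theorem reach (S : MatchingState k n₀ c f I R σ) (hi : i ∈ I) (hiR : i ∉ R)
    (hj : j ∉ (I \ R).image σ) (h0 : c i j = 0) :
    MatchingState k n₀ c f I (insert i R) σ where
  nonneg := S.nonneg
  kpos := S.kpos
  subset := Finset.insert_subset hi S.subset
  injOn := S.injOn
  zero := S.zero
  zero_or_std := S.zero_or_std
  std_beyond := S.std_beyond
  exists_rearrangement j' hj' := by
    by_cases hold : j' ∉ (I \ R).image σ
    · obtain ⟨τ, hinj, heq, hzero, hne, hcov⟩ := S.exists_rearrangement j' hold
      refine ⟨τ, hinj, fun a ha => heq a ?_, hzero, hne, hcov⟩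
      simp only [Finset.mem_sdiff, Finset.mem_insert, not_or] at ha ⊢
      exact ⟨ha.1, ha.2.2⟩
    · have hj'i : j' = σ i := by
        rw [not_not] at hold
        obtain ⟨a, ha, rfl⟩ := Finset.mem_image.1 hold
        by_contra hne
        refine hj' (Finset.mem_image.2 ⟨a, ?_, rfl⟩)
        simp only [Finset.mem_sdiff, Finset.mem_insert, not_or] at ha ⊢
        exact ⟨ha.1, fun e => hne (by rw [e]), ha.2⟩
      subst hj'i
      obtain ⟨τ, hinj, heq, hzero, hne, hcov⟩ := S.exists_rearrangement j hj
      have hτi : τ i = σ i := heq i (Finset.mem_sdiff.2 ⟨hi, hiR⟩)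
      have hji : j ≠ σ i := fun e =>
        hj (Finset.mem_image.2 ⟨i, Finset.mem_sdiff.2 ⟨hi, hiR⟩, e.symm⟩)
      -- The newly uncovered column is `σ i`. It is vacated by taking the rearrangement that avoids
      -- `j` and moving row `i` to its zero in column `j`.
      refine ⟨Function.update τ i j, ?_, ?_, ?_, ?_, ?_⟩
      · intro a ha b hb hab
        by_cases hai : a = i <;> by_cases hbi : b = i
        · rw [hai, hbi]
        · rw [hai, Function.update_self, Function.update_of_ne hbi] at hab
          exact absurd hab.symm (hne b hb)
        · rw [hbi, Function.update_self, Function.update_of_ne hai] at hab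
          exact absurd hab (hne a ha)
        · rw [Function.update_of_ne hai, Function.update_of_ne hbi] at hab
          exact hinj ha hb hab
      · intro a ha
        simp only [Finset.mem_sdiff, Finset.mem_insert, not_or] at ha
        rw [Function.update_of_ne ha.2.1]
        exact heq a (Finset.mem_sdiff.2 ⟨ha.1, ha.2.2⟩)
      · intro a ha
        by_cases hai : a = i
        · subst hai; rwa [Function.update_self]
        · rw [Function.update_of_ne hai]; exact hzero a ha
      · intro a ha
        by_cases hai : a = i
        · subst hai; rwa [Function.update_self]
        · rw [Function.update_of_ne hai, ← hτi]
          exact fun e => hai (hinj ha hi e)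
      · intro a ha
        by_cases hai : a = i
        · exact Or.inl (by rw [hai])
        · right
          rcases hcov a ha with h | h
          · exact Finset.mem_image.2 ⟨i, hi, by rw [Function.update_self, h]⟩
          · obtain ⟨b, hb, hba⟩ := Finset.mem_image.1 h
            refine Finset.mem_image.2 ⟨b, hb, ?_⟩
            rw [Function.update_of_ne, hba]
            rintro rfl
            rw [hτi] at hba
            exact hai (S.injOn ha hi hba.symm)

/-- Augmenting the matching along an alternating path. -/
theorem augment (S : MatchingState k n₀ c f I R σ) (hi : i ∉ I)
    (hj : j ∉ (I \ R).image σ) (h0 : c i j = 0) :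
    ∃ σ', MatchingState k n₀ c f (insert i I) ∅ σ' := by
  obtain ⟨τ, hinj, heq, hzero, hne, hcov⟩ := S.exists_rearrangement j hj
  have hup : ∀ a ∈ I, Function.update τ i j a = τ a := fun a ha =>
    Function.update_of_ne (fun e => hi (by rwa [← e])) _ _
  have hinj' : Set.InjOn (Function.update τ i j) (insert i I : Finset (Fin m)) := by
    intro a ha b hb hab
    rw [Finset.mem_coe, Finset.mem_insert] at ha hb
    rcases ha with rfl | ha <;> rcases hb with rfl | hb
    · rfl
    · rw [Function.update_self, hup b hb] at hab
      exact absurd hab.symm (hne b hb)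
    · rw [Function.update_self, hup a ha] at hab
      exact absurd hab (hne a ha)
    · rw [hup a ha, hup b hb] at hab
      exact hinj ha hb hab
  have hzero' : ∀ a ∈ insert i I, c a (Function.update τ i j a) = 0 := by
    intro a ha
    rcases Finset.mem_insert.1 ha with rfl | ha
    · rwa [Function.update_self]
    · rw [hup a ha]; exact hzero a ha
  refine ⟨Function.update τ i j, S.nonneg, S.kpos, Finset.empty_subset _, hinj', hzero', ?_,
    S.std_beyond, ?_⟩
  · intro a b hb
    -- Every formerly matched column is still matched, so the columns unmatched now already
    -- satisfied the dichotomy.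
    refine S.zero_or_std a b fun hmem => hb ?_
    obtain ⟨d, hd, rfl⟩ := Finset.mem_image.1 hmem
    rcases hcov d hd with h | h
    · exact Finset.mem_image.2 ⟨i, Finset.mem_insert_self _ _, by rw [Function.update_self, h]⟩
    · obtain ⟨b, hb, hbd⟩ := Finset.mem_image.1 h
      exact Finset.mem_image.2 ⟨b, Finset.mem_insert_of_mem hb, by rw [hup b hb, hbd]⟩
  · intro b hb
    rw [Finset.sdiff_empty] at hb
    exact ⟨_, hinj', fun _ _ => rfl, hzero', fun a ha e => hb (Finset.mem_image.2 ⟨a, ha, e⟩),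
      fun a ha => Or.inr (Finset.mem_image_of_mem _ ha)⟩

theorem isAssignment (S : MatchingState k n₀ c f I R σ) {n : ℕ} (hn : n₀ ≤ n) :
    IsAssignment I.card
      (Finset.univ.filter fun e : Fin m × Fin n => e.1 ∈ I ∧ (e.2 : ℕ) = σ e.1) := by
  constructor
  · symm
    refine Finset.card_bij (fun i hi => (i, ⟨σ i, (S.matched_lt hi).trans_le hn⟩)) ?_ ?_ ?_
    · intro a ha; simpa using ha
    · intro a _ b _ hab; simpa using (Prod.mk.inj hab).1
    · rintro ⟨a, b⟩ hab
      simp only [Finset.mem_filter, Finset.mem_univ, true_and] at hab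
      exact ⟨a, hab.1, by ext <;> simp [hab.2]⟩
  · rintro ⟨a, b⟩ hab ⟨a', b'⟩ hab' hne
    simp only [Finset.mem_filter, Finset.mem_univ, true_and] at hab hab'
    have haa : a ≠ a' := by
      rintro rfl
      exact hne (by ext <;> simp [hab.2, hab'.2])
    refine ⟨haa, fun e => haa (S.injOn hab.1 hab'.1 ?_)⟩
    rw [← hab.2, ← hab'.2]
    exact congrArg Fin.val e

theorem meanCost_eq_zero (S : MatchingState k n₀ c f I R σ) {n : ℕ} (hn : n₀ ≤ n)
    (hk : k ≤ I.card) : meanCost k n c f = 0 := by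
  unfold meanCost
  rw [lintegral_congr_ae (g := fun _ => 0), lintegral_zero]
  filter_upwards [ae_nonneg_expPi fun v : FinVar q m n => f v.emb n] with y hy
  rw [minAssignmentSum_eq_zero (formMatrix_nonneg S.nonneg hy) (S.isAssignment hn) hk,
    ENNReal.ofReal_zero]
  rintro ⟨a, b⟩ hab
  simp only [Finset.mem_filter, Finset.mem_univ, true_and] at hab
  simp [formMatrix, hab.2, S.zero a hab.1]

end MatchingState

end State

/-! ### One step: conditioning on the minimum and subtracting it. -/

section Step

variable {q m k : ℕ}

/-- The coefficient of the minimum `t` of the standard variables in uncovered positions and the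
variables in `O`, after `t` is subtracted from the uncovered entries and added to the doubly
covered ones. -/
def stepCoeff (c : Fin m → ℕ → Var q m → ℝ) (I R : Finset (Fin m)) (σ : Fin m → ℕ)
    (O : Finset (Var q m)) (i : Fin m) (j : ℕ) : ℝ :=
  (if i ∉ R ∧ j ∉ I.image σ then 1 else ∑ v ∈ O, c i j v) -
    (1 - (if i ∈ R then 1 else 0) - (if j ∈ (I \ R).image σ then 1 else 0))

/-- The linear forms after a step in which the minimal variable is `w`. -/
def stepForms (c : Fin m → ℕ → Var q m → ℝ) (I R : Finset (Fin m)) (σ : Fin m → ℕ)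
    (O : Finset (Var q m)) (w : Var q m) (i : Fin m) (j : ℕ) : Var q m → ℝ :=
  Function.update (c i j) w (stepCoeff c I R σ O i j)

/-- The rate of the minimum of the standard variables in uncovered positions and the variables
in `O`. -/
def stepRate (f : Var q m → ℝ → ℝ) (I R : Finset (Fin m)) (O : Finset (Var q m)) (x : ℝ) : ℝ :=
  ((m - R.card : ℕ) : ℝ) * (x - I.card) + ∑ v ∈ O, f v x

/-- The uncovered positions in unmatched columns. -/
def uncoveredVars (q n : ℕ) (I R : Finset (Fin m)) (σ : Fin m → ℕ) : Finset (Var q m) :=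
  (Rᶜ ×ˢ (Finset.range n \ I.image σ)).map ⟨Sum.inr, Sum.inr_injective⟩

variable {n₀ : ℕ} {c : Fin m → ℕ → Var q m → ℝ} {f : Var q m → ℝ → ℝ} {I R : Finset (Fin m)}
  {σ : Fin m → ℕ} {O : Finset (Var q m)}

theorem isKPositive_stepRate (hf : ∀ v, IsKPositive k (f v)) (hI : I.card < k) (hR : R.card < m) :
    IsKPositive k (stepRate f I R O) := by
  classical
  unfold stepRate
  induction O using Finset.induction_on with
  | empty => simpa using isKPositive_mul_sub (Nat.sub_pos_of_lt hR) hI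
  | insert a s ha ih =>
    have := ih.add (hf a)
    simpa only [Finset.sum_insert ha, add_assoc, add_comm (f a _)] using this

namespace MatchingState

/-- The data of a step: no uncovered position is identically zero, and each uncovered entry in a
matched column is at least the sum of the variables in `O`, with coefficients at least one. -/
structure Steppable (c : Fin m → ℕ → Var q m → ℝ) (f : Var q m → ℝ → ℝ) (I R : Finset (Fin m))
    (σ : Fin m → ℕ) (O : Finset (Var q m)) : Prop where
  ne_zero : ∀ i j, i ∉ R → j ∉ (I \ R).image σ → c i j ≠ 0
  free : ∀ v ∈ O, Free c f I σ v
  one_le : ∀ i j, i ∉ R → j ∈ R.image σ → 1 ≤ ∑ v ∈ O, c i j v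

theorem isStd_of_uncovered (S : MatchingState k n₀ c f I R σ)
    (T : Steppable c f I R σ O) {i : Fin m} {j : ℕ} (hi : i ∉ R) (hj : j ∉ I.image σ) :
    IsStd c f i j :=
  (S.zero_or_std i j hj).resolve_left (T.ne_zero i j hi fun h =>
    hj (Finset.image_subset_image Finset.sdiff_subset h))

theorem sum_free_eq_zero (T : Steppable c f I R σ O) {i : Fin m} {j : ℕ} (hj : j ∉ I.image σ) (h : IsStd c f i j) :
    ∑ v ∈ O, c i j v = 0 :=
  Finset.sum_eq_zero fun v hv => h.apply_eq_zero (T.free v hv i j hj h)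

/-- The only delicate positions are uncovered ones in `σ(R)`, where `1` is subtracted from the sum
over `O`; `one_le` covers exactly these. -/
theorem stepCoeff_nonneg (S : MatchingState k n₀ c f I R σ)
    (T : Steppable c f I R σ O) (i : Fin m) (j : ℕ) : 0 ≤ stepCoeff c I R σ O i j := by
  have h0 : 0 ≤ ∑ v ∈ O, c i j v := Finset.sum_nonneg fun v _ => S.nonneg i j v
  unfold stepCoeff
  by_cases hi : i ∈ R <;> by_cases hj : j ∈ (I \ R).image σ <;> by_cases hjI : j ∈ I.image σ <;>
    simp only [hi, hj, hjI, not_true_eq_false, not_false_eq_true, if_true, if_false, and_true,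
      and_false] <;> try linarith
  have : j ∈ R.image σ := by
    obtain ⟨a, ha, rfl⟩ := Finset.mem_image.1 hjI
    refine Finset.mem_image_of_mem _ ?_
    by_contra haR
    exact hj (Finset.mem_image_of_mem _ (Finset.mem_sdiff.2 ⟨ha, haR⟩))
  linarith [T.one_le i j hi this]

theorem stepCoeff_of_zero (T : Steppable c f I R σ O) {i : Fin m} {j : ℕ} (h : c i j = 0)
    (hd : ¬ (i ∈ R ∧ j ∈ (I \ R).image σ)) : stepCoeff c I R σ O i j = 0 := by
  have h0 : ∑ v ∈ O, c i j v = 0 := by simp [h]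
  unfold stepCoeff
  by_cases hi : i ∈ R
  · have hj : j ∉ (I \ R).image σ := fun hj => hd ⟨hi, hj⟩
    simp [hi, hj, h0]
  · by_cases hj : j ∈ (I \ R).image σ
    · have hjI : j ∈ I.image σ := Finset.image_subset_image Finset.sdiff_subset hj
      simp only [hi, hj, hjI, h0, not_true_eq_false, and_false, if_false, if_true]
      norm_num
    · exact absurd h (T.ne_zero i j hi hj)

theorem stepCoeff_of_std (T : Steppable c f I R σ O) {i : Fin m} {j : ℕ} (hj : j ∉ I.image σ) (h : IsStd c f i j) :
    stepCoeff c I R σ O i j = 0 := by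
  have h0 := sum_free_eq_zero T hj h
  have hj' : j ∉ (I \ R).image σ := fun h => hj (Finset.image_subset_image Finset.sdiff_subset h)
  unfold stepCoeff
  by_cases hi : i ∈ R <;> simp [hi, hj, hj', h0]

theorem step (S : MatchingState k n₀ c f I R σ)
    (T : Steppable c f I R σ O) (hI : I.card < k) (hR : R.card < m) {n₁ : ℕ} (hn : n₀ ≤ n₁) {w : Var q m}
    (hw : w.Below n₁) :
    MatchingState k n₁ (stepForms c I R σ O w) (Function.update f w (stepRate f I R O)) I R σ :=
  S.update hn hw (S.stepCoeff_nonneg T) (isKPositive_stepRate S.kpos hI hR)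
    (fun _ _ h hd => stepCoeff_of_zero T h hd) fun _ _ hj h => stepCoeff_of_std T hj h

/-- This is the progress made when a standard variable is minimal: the entry was that variable
alone, and it is subtracted in full. -/
theorem stepForms_eq_zero (S : MatchingState k n₀ c f I R σ)
    (T : Steppable c f I R σ O) {i : Fin m} {j : ℕ} (hi : i ∉ R) (hj : j ∉ I.image σ) :
    stepForms c I R σ O (Sum.inr (i, j)) i j = 0 := by
  have h := S.isStd_of_uncovered T hi hj
  ext v
  unfold stepForms
  by_cases hv : v = Sum.inr (i, j)
  · subst hv; simpa using stepCoeff_of_std T hj h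
  · simpa [hv] using h.apply_eq_zero hv

theorem disjoint_uncoveredVars (S : MatchingState k n₀ c f I R σ)
    (T : Steppable c f I R σ O) (n : ℕ) : Disjoint O (uncoveredVars q n I R σ) := by
  rw [Finset.disjoint_left]
  intro v hv hmem
  obtain ⟨⟨i, j⟩, hij, rfl⟩ := Finset.mem_map.1 hmem
  simp only [Finset.mem_product, Finset.mem_compl, Finset.mem_sdiff] at hij
  exact T.free _ hv i j hij.2.2 (S.isStd_of_uncovered T hij.1 hij.2.2) rfl

theorem sum_coeff_eq (S : MatchingState k n₀ c f I R σ)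
    (T : Steppable c f I R σ O) {n : ℕ} (i : Fin m) {j : ℕ} (hj : j < n) :
    ∑ u ∈ O ∪ uncoveredVars q n I R σ, c i j u =
      if i ∉ R ∧ j ∉ I.image σ then 1 else ∑ v ∈ O, c i j v := by
  rw [Finset.sum_union (S.disjoint_uncoveredVars T n), uncoveredVars, Finset.sum_map]
  have hother : ∀ p ∈ Rᶜ ×ˢ (Finset.range n \ I.image σ), p ≠ (i, j) →
      c i j (Sum.inr p) = 0 := by
    rintro ⟨a, b⟩ hp hne
    simp only [Finset.mem_product, Finset.mem_compl, Finset.mem_sdiff] at hp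
    exact (S.isStd_of_uncovered T hp.1 hp.2.2).unique i j hne.symm
  by_cases h : i ∉ R ∧ j ∉ I.image σ
  · have hstd := S.isStd_of_uncovered T h.1 h.2
    rw [if_pos h, sum_free_eq_zero T h.2 hstd, zero_add, Finset.sum_eq_single (i, j)]
    · simp [hstd.eq_single]
    · exact fun p hp hne => hother p hp hne
    · intro hn
      refine absurd ?_ hn
      simpa [hj] using h
  · rw [if_neg h, add_eq_left]
    refine Finset.sum_eq_zero fun p hp => hother p hp ?_
    rintro rfl
    simp only [Finset.mem_product, Finset.mem_compl, Finset.mem_sdiff] at hp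
    exact h ⟨hp.1, hp.2.2⟩

/-- There are `(m - |R|)(n - |I|)` uncovered positions in unmatched columns, each with a variable of
rate `1`; hence the rate of the minimum is linear in `n`. -/
theorem sum_rate_eq (S : MatchingState k n₀ c f I R σ)
    (T : Steppable c f I R σ O) {n : ℕ} (hn : n₀ ≤ n) :
    stepRate f I R O n = ∑ u ∈ O ∪ uncoveredVars q n I R σ, f u n := by
  rw [Finset.sum_union (S.disjoint_uncoveredVars T n), uncoveredVars, Finset.sum_map,
    Finset.sum_congr (s₁ := Rᶜ ×ˢ _) rfl (g := fun _ => (1 : ℝ))]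
  · have hsub : I.image σ ⊆ Finset.range n := fun j hj =>
      Finset.mem_range.2 ((S.lt_of_mem_image hj).trans_le hn)
    have hcard : (I.image σ).card = I.card := Finset.card_image_of_injOn S.injOn
    have hle := Finset.card_le_card hsub
    rw [hcard, Finset.card_range] at hle
    rw [Finset.sum_const, Finset.card_product, Finset.card_sdiff_of_subset hsub, hcard,
      Finset.card_compl, Fintype.card_fin, Finset.card_range, nsmul_eq_mul, mul_one, stepRate]
    push_cast [Nat.cast_sub hle]
    ring
  · rintro ⟨a, b⟩ hp
    simp only [Finset.mem_product, Finset.mem_compl, Finset.mem_sdiff] at hp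
    exact (S.isStd_of_uncovered T hp.1 hp.2.2).rate n

/-- The dual step is applied pointwise with `t` the value of `w`. Its gain `t (k - |I|)` integrates
to the constant, since the minimum has mean `1 / rate`. -/
theorem lintegral_step (S : MatchingState k n₀ c f I R σ)
    (T : Steppable c f I R σ O) (hkm : k ≤ m) (hI : I.card < k) (hR : R.card < m) {n : ℕ} (hn : n₀ ≤ n)
    (hkn : k ≤ n₀) {w : Var q m} (hw : w.Below n) :
    meanCost k n (fun i j => Function.update (c i j) w
        (if i ∉ R ∧ j ∉ I.image σ then 1 else ∑ v ∈ O, c i j v))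
      (Function.update f w (stepRate f I R O)) =
    meanCost k n (stepForms c I R σ O w) (Function.update f w (stepRate f I R O)) +
      ENNReal.ofReal ((k - I.card : ℝ) / stepRate f I R O n) := by
  classical
  have S' := S.step T hI hR hn hw
  obtain ⟨u, rfl⟩ := hw.exists_emb
  have hkn' : (k : ℝ) ≤ n := by exact_mod_cast hkn.trans hn
  have hkI : (0 : ℝ) ≤ k - I.card := sub_nonneg.2 (by exact_mod_cast hI.le)
  have hrate : 0 < stepRate f I R O n := (isKPositive_stepRate S.kpos hI hR).2 n hkn'
  have hmean := lintegral_ofReal_eval_expPi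
    (fun v : FinVar q m n => Function.update f u.emb (stepRate f I R O) v.emb n) (v := u)
    (by simpa using hrate)
  simp only [Function.update_self] at hmean
  have hconst : ENNReal.ofReal ((k - I.card : ℝ) / stepRate f I R O n) =
      ∫⁻ y, ENNReal.ofReal (k - I.card : ℝ) * ENNReal.ofReal (y u)
        ∂expPi (fun v : FinVar q m n => Function.update f u.emb (stepRate f I R O) v.emb n) := by
    rw [lintegral_const_mul _ (by fun_prop), hmean, ← ENNReal.ofReal_mul hkI, mul_one_div]
  rw [hconst, meanCost, meanCost, ← lintegral_add_left measurable_cost]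
  refine lintegral_congr_ae ?_
  filter_upwards [ae_nonneg_expPi fun v : FinVar q m n =>
    Function.update f u.emb (stepRate f I R O) v.emb n] with y hy
  have hB := formMatrix_nonneg (n := n) S'.nonneg hy
  have hM := S.isAssignment hn
  have hCcard : (Finset.univ.filter fun j : Fin n => (j : ℕ) ∈ (I \ R).image σ).card =
      (I \ R).card := by
    rw [← Finset.card_image_of_injOn (S.injOn.mono (Finset.coe_subset.2 Finset.sdiff_subset))]
    refine Finset.card_bij (fun j _ => (j : ℕ)) (fun j hj => by simpa using hj)
      (fun a _ b _ h => Fin.val_injective h) fun j hj => ?_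
    have hlt : j < n := (S.lt_of_mem_image (Finset.image_subset_image Finset.sdiff_subset hj)).trans_le
      hn
    exact ⟨⟨j, hlt⟩, by simpa using hj, rfl⟩
  rw [minAssignmentSum_eq_add_mul hkm (hkn.trans hn) hB (hy u) hM hI.le (R := R)
    (C := Finset.univ.filter fun j : Fin n => (j : ℕ) ∈ (I \ R).image σ) ?_ ?_ ?_ ?_ ?_,
    ENNReal.ofReal_add (minAssignmentSum_nonneg hB) (mul_nonneg (hy u) hkI), mul_comm (y u),
    ENNReal.ofReal_mul hkI]
  · rintro ⟨a, b⟩ hab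
    simp only [Finset.mem_filter, Finset.mem_univ, true_and] at hab
    simp [formMatrix, hab.2, S'.zero a hab.1]
  · intro i hi
    refine ⟨(i, ⟨σ i, (S.matched_lt (S.subset hi)).trans_le hn⟩), ?_, rfl⟩
    simpa using S.subset hi
  · intro j hj
    simp only [Finset.mem_filter, Finset.mem_univ, true_and] at hj
    obtain ⟨i, hi, hij⟩ := Finset.mem_image.1 hj
    exact ⟨(i, j), by simpa [hij] using (Finset.mem_sdiff.1 hi).1, rfl⟩
  · rw [hCcard, Finset.card_sdiff_of_subset S.subset]
    have := Finset.card_le_card S.subset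
    omega
  · intro i j
    unfold stepForms
    rw [formMatrix_update, formMatrix_update (φ := stepCoeff c I R σ O)]
    simp only [Finset.mem_filter, Finset.mem_univ, true_and, stepCoeff]
    ring

theorem meanCost_step (S : MatchingState k n₀ c f I R σ)
    (T : Steppable c f I R σ O) (hkm : k ≤ m) (hI : I.card < k) (hR : R.card < m) {n : ℕ} (hn : n₀ ≤ n)
    (hkn : k ≤ n₀) :
    meanCost k n c f = ∑ w ∈ O ∪ uncoveredVars q n I R σ,
      ENNReal.ofReal (f w n / stepRate f I R O n) *
      (meanCost k n (stepForms c I R σ O w) (Function.update f w (stepRate f I R O)) +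
        ENNReal.ofReal ((k - I.card : ℝ) / stepRate f I R O n)) := by
  have hkn' : (k : ℝ) ≤ n := by exact_mod_cast hkn.trans hn
  have hrate : 0 < stepRate f I R O n := (isKPositive_stepRate S.kpos hI hR).2 n hkn'
  have hbelow : ∀ v ∈ O ∪ uncoveredVars q n I R σ, v.Below n := by
    intro v hv
    rcases Finset.mem_union.1 hv with hv | hv
    · exact (Free.below S (T.free v hv)).mono hn
    · obtain ⟨⟨i, j⟩, hij, rfl⟩ := Finset.mem_map.1 hv
      simp only [Finset.mem_product, Finset.mem_sdiff, Finset.mem_range] at hij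
      rintro a b hab
      simp only [Function.Embedding.coeFn_mk, Sum.inr.injEq, Prod.mk.injEq] at hab
      exact hab.2 ▸ hij.2.1
  -- An empty family would have total rate `0`, contradicting the positivity of `stepRate`.
  have hne : (O ∪ uncoveredVars q n I R σ).Nonempty := by
    by_contra h
    rw [Finset.not_nonempty_iff_eq_empty] at h
    have := S.sum_rate_eq T hn
    rw [h, Finset.sum_empty] at this
    exact hrate.ne' this
  rw [meanCost_split_min _ hne hbelow (fun v => (S.kpos v).2 n hkn')
    (φ := fun i j => if i ∉ R ∧ j ∉ I.image σ then 1 else ∑ v ∈ O, c i j v)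
    (fun i j hj => (S.sum_coeff_eq T i hj).symm) (S.sum_rate_eq T hn)]
  exact Finset.sum_congr rfl fun w hw => by
    rw [S.lintegral_step T hkm hI hR hn hkn (hbelow w hw)]

end MatchingState

end Step

/-! ### Summing over the outcomes of a step, uniformly in `n`. -/

section Recursion

variable {q m k n₀ : ℕ} {c : Fin m → ℕ → Var q m → ℝ} {f : Var q m → ℝ → ℝ}
  {I R : Finset (Fin m)} {σ : Fin m → ℕ} {O : Finset (Var q m)}

namespace MatchingState

/-- All columns beyond `n₀` are equivalent. -/
theorem meanCost_step_beyond (S : MatchingState k n₀ c f I R σ) (T : Steppable c f I R σ O)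
    {i : Fin m} {j n : ℕ} (hj : n₀ ≤ j) (hjn : j < n) :
    meanCost k n (stepForms c I R σ O (Sum.inr (i, j)))
        (Function.update f (Sum.inr (i, j)) (stepRate f I R O)) =
      meanCost k n (stepForms c I R σ O (Sum.inr (i, n₀)))
        (Function.update f (Sum.inr (i, n₀)) (stepRate f I R O)) := by
  -- Columns `n₀` and `j` are exchanged; both consist of standard entries, and the forms in the
  -- first `n₀` columns do not involve their variables.
  let π : Equiv.Perm (Fin n) := Equiv.swap ⟨n₀, hj.trans_lt hjn⟩ ⟨j, hjn⟩
  have hfix : ∀ l : Fin n, (l : ℕ) < n₀ → π l = l := by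
    intro l hl
    refine Equiv.swap_apply_of_ne_of_ne ?_ ?_ <;> (rintro rfl; simp at hl; try omega)
  have hmove : ∀ l : Fin n, n₀ ≤ (l : ℕ) → n₀ ≤ (π l : ℕ) := by
    intro l hl
    by_contra! h
    have := hfix (π l) h
    rw [π.injective this] at h
    omega
  have hw : ∀ v : FinVar q m n,
      FinVar.emb (Equiv.sumCongr (Equiv.refl _) (Equiv.prodCongr (Equiv.refl _) π) v) =
        Sum.inr (i, j) ↔ v.emb = Sum.inr (i, n₀) := by
    rintro (l | ⟨a, l⟩)
    · simp [FinVar.emb]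
    · have : ((π l : Fin n) : ℕ) = j ↔ (l : ℕ) = n₀ := by
        have h1 : (π l = ⟨j, hjn⟩) ↔ l = ⟨n₀, hj.trans_lt hjn⟩ := by
          have e : π ⟨n₀, hj.trans_lt hjn⟩ = ⟨j, hjn⟩ := Equiv.swap_apply_left _ _
          rw [← e]
          exact π.injective.eq_iff
        simpa [Fin.ext_iff] using h1
      simp [FinVar.emb, this]
  have hc : ∀ (a : Fin m) (l : Fin n) (v : FinVar q m n),
      c a (π l) (FinVar.emb (Equiv.sumCongr (Equiv.refl _)
        (Equiv.prodCongr (Equiv.refl _) π) v)) = c a l v.emb := by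
    intro a l v
    rcases lt_or_ge (l : ℕ) n₀ with hl | hl
    · rw [hfix l hl]
      rcases v with v | ⟨b, x⟩
      · simp [FinVar.emb]
      · rcases lt_or_ge (x : ℕ) n₀ with hx | hx
        · simp [FinVar.emb, hfix x hx]
        · have h1 := (S.std_beyond b x hx).unique a l (fun e => by
            have := (Prod.mk.inj e).2; omega)
          have h2 := (S.std_beyond b (π x) (hmove x hx)).unique a l (fun e => by
            have := (Prod.mk.inj e).2; have := hmove x hx; omega)
          simp [FinVar.emb, h1, h2]
    · rw [(S.std_beyond a l hl).eq_single, (S.std_beyond a (π l) (hmove l hl)).eq_single]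
      rcases v with v | ⟨b, x⟩
      · simp [FinVar.emb]
      · simp [FinVar.emb, Pi.single_apply, Fin.val_inj]
  have hφ : ∀ (a : Fin m) (l : Fin n),
      stepCoeff c I R σ O a (π l) = stepCoeff c I R σ O a l := by
    intro a l
    rcases lt_or_ge (l : ℕ) n₀ with hl | hl
    · rw [hfix l hl]
    · rw [stepCoeff_of_std T (S.notMem_image_of_le hl) (S.std_beyond a l hl),
        stepCoeff_of_std T (S.notMem_image_of_le (hmove l hl)) (S.std_beyond a _ (hmove l hl))]
  refine meanCost_perm π (fun a l v => ?_) fun v => ?_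
  · unfold stepForms
    by_cases h : v.emb = Sum.inr (i, n₀)
    · rw [(hw v).2 h, h, Function.update_self, Function.update_self, hφ]
    · rw [Function.update_of_ne h, Function.update_of_ne (fun e => h ((hw v).1 e)), hc]
  · by_cases h : v.emb = Sum.inr (i, n₀)
    · rw [(hw v).2 h, h, Function.update_self, Function.update_self]
    · rw [Function.update_of_ne h, Function.update_of_ne (fun e => h ((hw v).1 e))]
      rcases v with v | ⟨b, x⟩
      · simp [FinVar.emb]
      · rcases lt_or_ge (x : ℕ) n₀ with hx | hx
        · simp [FinVar.emb, hfix x hx]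
        · have h1 := (S.std_beyond b x hx).rate n
          have h2 := (S.std_beyond b (π x) (hmove x hx)).rate n
          simp [FinVar.emb, h1, h2]

/-- The mean cost is rational in `n` if this holds after each possible outcome of a step. -/
theorem isRationalSeq_of_step (S : MatchingState k n₀ c f I R σ) (T : Steppable c f I R σ O)
    (hkm : k ≤ m) (hkn : k ≤ n₀) (hI : I.card < k) (hR : R.card < m)
    (hO : ∀ w ∈ O, IsRationalSeq k n₀ fun n =>
      meanCost k n (stepForms c I R σ O w) (Function.update f w (stepRate f I R O)))
    (hU : ∀ i ∉ R, ∀ j ∉ I.image σ, j ≤ n₀ → ∀ n₁, n₀ ≤ n₁ → j < n₁ → IsRationalSeq k n₁ fun n =>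
      meanCost k n (stepForms c I R σ O (Sum.inr (i, j)))
        (Function.update f (Sum.inr (i, j)) (stepRate f I R O))) :
    IsRationalSeq k n₀ fun n => meanCost k n c f := by
  have hkI : (0 : ℝ) < k - I.card := sub_pos.2 (by exact_mod_cast hI)
  have hrate := isKPositive_stepRate (O := O) S.kpos hI hR
  have hconst : ∀ n₁, k ≤ n₁ → IsRationalSeq k n₁ fun n =>
      ENNReal.ofReal ((k - I.card : ℝ) / stepRate f I R O n) := fun n₁ hn₁ =>
    IsKPositive.isRationalSeq_div hn₁ (f := fun _ => (k - I.card : ℝ))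
      ⟨⟨0, k - I.card, fun x => by simp⟩, fun _ _ => hkI⟩ hrate
  have hone : ∀ n₁, k ≤ n₁ → IsRationalSeq k n₁ fun n =>
      ENNReal.ofReal (1 / stepRate f I R O n) := fun n₁ hn₁ =>
    IsKPositive.isRationalSeq_div hn₁ isKPositive_one hrate
  let term : Var q m → ℕ → ℝ≥0∞ := fun w n =>
    meanCost k n (stepForms c I R σ O w) (Function.update f w (stepRate f I R O)) +
      ENNReal.ofReal ((k - I.card : ℝ) / stepRate f I R O n)
  -- The unmatched columns below `n₀` are summed individually. The remaining `n - n₀` columns all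
  -- contribute what column `n₀` does, a term controlled only from `n₀ + 1` on.
  have hgoal : IsRationalSeq k n₀ fun n =>
      ∑ w ∈ O, ENNReal.ofReal (f w n / stepRate f I R O n) * term w n +
      ∑ i ∈ Rᶜ, (∑ j ∈ Finset.range n₀ \ I.image σ,
          ENNReal.ofReal (1 / stepRate f I R O n) * term (Sum.inr (i, j)) n +
        ((n - n₀ : ℕ) : ℝ≥0∞) *
          (ENNReal.ofReal (1 / stepRate f I R O n) * term (Sum.inr (i, n₀)) n)) := by
    refine IsRationalSeq.add hkn (IsRationalSeq.sum hkn _ fun w hw => ?_)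
      (IsRationalSeq.sum hkn _ fun i hi => IsRationalSeq.add hkn
        (IsRationalSeq.sum hkn _ fun j hj => ?_) (IsRationalSeq.sub_mul ?_))
    · exact (IsKPositive.isRationalSeq_div hkn (S.kpos w) hrate).mul
        ((hO w hw).add hkn (hconst n₀ hkn))
    · rw [Finset.mem_sdiff, Finset.mem_range] at hj
      exact (hone n₀ hkn).mul ((hU i (Finset.mem_compl.1 hi) j hj.2 hj.1.le n₀ le_rfl hj.1).add hkn
        (hconst n₀ hkn))
    · have hkn₁ : k ≤ n₀ + 1 := hkn.trans (Nat.le_succ _)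
      exact (hone _ hkn₁).mul ((hU i (Finset.mem_compl.1 hi) n₀ (S.notMem_image_of_le le_rfl) le_rfl
        (n₀ + 1) (Nat.le_succ _) (Nat.lt_succ_self _)).add hkn₁ (hconst _ hkn₁))
  refine hgoal.congr fun n hn => ?_
  rw [S.meanCost_step T hkm hI hR hn hkn, Finset.sum_union (S.disjoint_uncoveredVars T n),
    uncoveredVars, Finset.sum_map, Finset.sum_product]
  congr 1
  refine Finset.sum_congr rfl fun i hi => ?_
  rw [Finset.mem_compl] at hi
  have hsplit : Finset.range n \ I.image σ = (Finset.range n₀ \ I.image σ) ∪ Finset.Ico n₀ n := by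
    ext j
    simp only [Finset.mem_sdiff, Finset.mem_range, Finset.mem_union, Finset.mem_Ico]
    constructor
    · rintro ⟨h1, h2⟩
      rcases lt_or_ge j n₀ with h | h
      exacts [Or.inl ⟨h, h2⟩, Or.inr ⟨h, h1⟩]
    · rintro (⟨h1, h2⟩ | ⟨h1, h2⟩)
      exacts [⟨h1.trans_le hn, h2⟩, ⟨h2, S.notMem_image_of_le h1⟩]
  have hdisj : Disjoint (Finset.range n₀ \ I.image σ) (Finset.Ico n₀ n) := by
    rw [Finset.disjoint_left]
    intro j h1 h2
    rw [Finset.mem_sdiff, Finset.mem_range] at h1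
    rw [Finset.mem_Ico] at h2
    omega
  rw [hsplit, Finset.sum_union hdisj]
  congr 1
  · refine Finset.sum_congr rfl fun j hj => ?_
    rw [Finset.mem_sdiff] at hj
    simp only [Function.Embedding.coeFn_mk, (S.isStd_of_uncovered T hi hj.2).rate, term]
  · rw [← Nat.card_Ico, ← nsmul_eq_mul, ← Finset.sum_const]
    refine Finset.sum_congr rfl fun j hj => ?_
    rw [Finset.mem_Ico] at hj
    simp only [Function.Embedding.coeFn_mk, (S.std_beyond i j hj.1).rate, term,
      S.meanCost_step_beyond T hj.1 hj.2]

end MatchingState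

end Recursion

/-! ### Comparable entries and the termination of the recursion. -/

section Recursion

variable {q m k n₀ : ℕ} {c : Fin m → ℕ → Var q m → ℝ} {f : Var q m → ℝ → ℝ}
  {I R : Finset (Fin m)} {σ : Fin m → ℕ}

namespace MatchingState

/-- The statement that every state with this matching size and this number of reached rows has a
mean cost that is rational in `n`. -/
def RationalAt (q m k a b : ℕ) : Prop :=
  ∀ (n₀ : ℕ) (c : Fin m → ℕ → Var q m → ℝ) (f : Var q m → ℝ → ℝ) (I R : Finset (Fin m))
    (σ : Fin m → ℕ), k ≤ n₀ → I.card = a → R.card = b → MatchingState k n₀ c f I R σ →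
      IsRationalSeq k n₀ fun n => meanCost k n c f

/-- An uncovered zero always makes progress: in a matched row it extends `R`, in an unmatched row it
enlarges the matching and `R` is reset to `∅`. -/
theorem isRationalSeq_of_zero (S : MatchingState k n₀ c f I R σ) (hkn : k ≤ n₀)
    (hreach : RationalAt q m k I.card (R.card + 1)) (haug : RationalAt q m k (I.card + 1) 0)
    {i : Fin m} {j : ℕ} (hi : i ∉ R) (hj : j ∉ (I \ R).image σ) (h0 : c i j = 0) :
    IsRationalSeq k n₀ fun n => meanCost k n c f := by
  by_cases hiI : i ∈ I
  · exact hreach n₀ c f I (insert i R) σ hkn rfl (Finset.card_insert_of_notMem hi)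
      (S.reach hiI hi hj h0)
  · obtain ⟨σ', S'⟩ := S.augment hiI hj h0
    exact haug n₀ c f (insert i I) ∅ σ' hkn (Finset.card_insert_of_notMem hiI) rfl S'

/-- If a standard variable is minimal, an uncovered zero appears and the recursive hypotheses apply;
only the outcomes in `O` remain to be treated. -/
theorem isRationalSeq_of_steppable (S : MatchingState k n₀ c f I R σ) {O : Finset (Var q m)}
    (T : Steppable c f I R σ O) (hkm : k ≤ m) (hkn : k ≤ n₀) (hI : I.card < k)
    (hreach : RationalAt q m k I.card (R.card + 1)) (haug : RationalAt q m k (I.card + 1) 0)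
    (hO : ∀ w ∈ O, IsRationalSeq k n₀ fun n =>
      meanCost k n (stepForms c I R σ O w) (Function.update f w (stepRate f I R O))) :
    IsRationalSeq k n₀ fun n => meanCost k n c f := by
  have hR : R.card < m := (Finset.card_le_card S.subset).trans_lt (hI.trans_le hkm)
  refine S.isRationalSeq_of_step T hkm hkn hI hR hO fun i hi j hj _ n₁ hn₁ hjn => ?_
  refine (S.step T hI hR hn₁ (w := Sum.inr (i, j)) ?_).isRationalSeq_of_zero (hkn.trans hn₁)
    hreach haug hi (fun h => hj (Finset.image_subset_image Finset.sdiff_subset h))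
    (S.stepForms_eq_zero T hi hj)
  intro a b hab
  simp only [Sum.inr.injEq, Prod.mk.injEq] at hab
  exact hab.2 ▸ hjn

theorem scale (S : MatchingState k n₀ c f I R σ) {v : Var q m} (hv : Free c f I σ v) {a : ℝ}
    (ha : 0 < a) :
    MatchingState k n₀ (fun i j => Function.update (c i j) v (c i j v / a))
      (Function.update f v fun x => f v x / a) I R σ :=
  S.update le_rfl (Free.below S hv) (fun i j => div_nonneg (S.nonneg i j v) ha.le)
    ((S.kpos v).div_const ha) (fun i j h _ => by simp [h]) fun i j hj h => by
      simp [h.apply_eq_zero (hv i j hj h)]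

theorem isRationalSeq_of_scale (S : MatchingState k n₀ c f I R σ) (hkn : k ≤ n₀) {v : Var q m}
    (hv : Free c f I σ v) {a : ℝ} (ha : 0 < a)
    (h : IsRationalSeq k n₀ fun n =>
      meanCost k n (fun i j => Function.update (c i j) v (c i j v / a))
        (Function.update f v fun x => f v x / a)) :
    IsRationalSeq k n₀ fun n => meanCost k n c f :=
  h.congr fun n hn => meanCost_scale ((Free.below S hv).mono hn)
    ((S.kpos v).2 n (by exact_mod_cast hkn.trans hn)) ha

/-- The variables occurring in the first `n` columns. -/
def lowVars (q m n : ℕ) : Finset (Var q m) :=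
  Finset.univ.map ⟨FinVar.emb, FinVar.emb_injective (n := n)⟩

theorem Free.mem_lowVars (S : MatchingState k n₀ c f I R σ) {v : Var q m}
    (hv : Free c f I σ v) : v ∈ lowVars q m n₀ := by
  obtain ⟨u, rfl⟩ := (Free.below S hv).exists_emb
  exact Finset.mem_map.2 ⟨u, Finset.mem_univ _, rfl⟩

/-- The case where one of the uncovered entries in matched columns is coefficientwise minimal. -/
theorem isRationalSeq_of_isLeast (hkm : k ≤ m) (hkn : k ≤ n₀) (hI : I.card < k)
    (hreach : RationalAt q m k I.card (R.card + 1)) (haug : RationalAt q m k (I.card + 1) 0)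
    {a : Fin m} {b : ℕ} (haR : a ∉ R) (hb : b ∈ R.image σ)
    (S : MatchingState k n₀ c f I R σ)
    (hmin : ∀ i j, i ∉ R → j ∈ R.image σ → ∀ v, c a b v ≤ c i j v) :
    IsRationalSeq k n₀ fun n => meanCost k n c f := by
  classical
  -- The induction is on the number of variables occurring in the least entry.
  induction hN : ((lowVars q m n₀).filter fun v => c a b v ≠ 0).card using Nat.strong_induction_on
    generalizing c f with
  | _ N ih =>
    by_cases hzero : ∃ i j, i ∉ R ∧ j ∉ (I \ R).image σ ∧ c i j = 0
    · obtain ⟨i, j, hi, hj, h0⟩ := hzero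
      exact S.isRationalSeq_of_zero hkn hreach haug hi hj h0
    push Not at hzero
    have hbI : b ∈ I.image σ := Finset.image_subset_image S.subset hb
    have hb' : b ∉ (I \ R).image σ := by
      intro h
      obtain ⟨x, hx, rfl⟩ := Finset.mem_image.1 hb
      obtain ⟨y, hy, hyx⟩ := Finset.mem_image.1 h
      rw [Finset.mem_sdiff] at hy
      exact hy.2 (S.injOn hy.1 (S.subset hx) hyx ▸ hx)
    -- Any variable of the least entry will do: once its coefficient there is scaled to `1`,
    -- leastness makes it at least `1` in every uncovered entry of `σ(R)`, so `O = {v}` gives a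
    -- step.
    obtain ⟨v, hv⟩ := Function.ne_iff.1 (hzero a b haR hb')
    have hvpos : 0 < c a b v := (S.nonneg a b v).lt_of_ne (Ne.symm hv)
    have hfree : Free c f I σ v := free_of_ne_zero hbI hv
    refine S.isRationalSeq_of_scale hkn hfree hvpos ?_
    have S₁ := S.scale hfree hvpos
    set c₁ : Fin m → ℕ → Var q m → ℝ := fun i j => Function.update (c i j) v (c i j v / c a b v)
      with hc₁
    set f₁ : Var q m → ℝ → ℝ := Function.update f v fun x => f v x / c a b v
    have hc₁v : ∀ i j, c₁ i j v = c i j v / c a b v := fun i j => Function.update_self _ _ _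
    have hc₁o : ∀ i j u, u ≠ v → c₁ i j u = c i j u := fun i j u hu => Function.update_of_ne hu _ _
    have h1 : c₁ a b v = 1 := by rw [hc₁v, div_self hvpos.ne']
    have hfree₁ : Free c₁ f₁ I σ v := free_of_ne_zero hbI (by rw [h1]; exact one_ne_zero)
    have hge : ∀ i j, i ∉ R → j ∈ R.image σ → 1 ≤ c₁ i j v := by
      intro i j hi hj
      rw [hc₁v, one_le_div hvpos]
      exact hmin i j hi hj v
    by_cases hzero₁ : ∃ i j, i ∉ R ∧ j ∉ (I \ R).image σ ∧ c₁ i j = 0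
    · obtain ⟨i, j, hi, hj, h0⟩ := hzero₁
      exact S₁.isRationalSeq_of_zero hkn hreach haug hi hj h0
    push Not at hzero₁
    have T : Steppable c₁ f₁ I R σ {v} :=
      ⟨hzero₁, by simpa using hfree₁, fun i j hi hj => by simpa using hge i j hi hj⟩
    refine S₁.isRationalSeq_of_steppable T hkm hkn hI hreach haug fun w hw => ?_
    rw [Finset.mem_singleton] at hw
    subst hw
    have hR : R.card < m := (Finset.card_le_card S.subset).trans_lt (hI.trans_le hkm)
    have hstep : ∀ i j, i ∉ R → j ∈ R.image σ → stepCoeff c₁ I R σ {w} i j = c₁ i j w - 1 := by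
      intro i j hi hj
      have hj1 : j ∈ I.image σ := Finset.image_subset_image S.subset hj
      have hj2 : j ∉ (I \ R).image σ := by
        intro h
        obtain ⟨x, hx, rfl⟩ := Finset.mem_image.1 hj
        obtain ⟨y, hy, hyx⟩ := Finset.mem_image.1 h
        rw [Finset.mem_sdiff] at hy
        exact hy.2 (S.injOn hy.1 (S.subset hx) hyx ▸ hx)
      simp only [stepCoeff, hi, hj1, hj2, not_true_eq_false, and_false, if_false,
        Finset.sum_singleton]
      ring
    have hab0 : stepForms c₁ I R σ {w} w a b w = 0 := by
      rw [stepForms, Function.update_self, hstep a b haR hb, h1, sub_self]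
    have hother : ∀ i j u, u ≠ w → stepForms c₁ I R σ {w} w i j u = c i j u := by
      intro i j u hu
      rw [stepForms, Function.update_of_ne hu, hc₁o i j u hu]
    -- When the chosen variable is the minimum, its coefficient drops by `1` in all uncovered
    -- entries of `σ(R)`. The least entry loses it and remains least.
    refine ih _ ?_ (S₁.step T hI hR le_rfl (Free.below S₁ hfree₁)) (fun i j hi hj u => ?_) rfl
    · rw [← hN]
      refine Finset.card_lt_card ⟨?_, ?_⟩
      · intro u hu
        rw [Finset.mem_filter] at hu ⊢
        have huw : u ≠ w := by rintro rfl; exact hu.2 hab0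
        rw [hother a b u huw] at hu
        exact hu
      · intro h
        have := h (Finset.mem_filter.2 ⟨Free.mem_lowVars S hfree, hv⟩)
        exact (Finset.mem_filter.1 this).2 hab0
    · by_cases hu : u = w
      · subst hu
        rw [hab0, stepForms, Function.update_self, hstep i j hi hj]
        linarith [hge i j hi hj]
      · rw [hother _ _ _ hu, hother _ _ _ hu]
        exact hmin i j hi hj u

/-- The two linear forms are comparable coefficientwise. -/
def Comparable (c : Fin m → ℕ → Var q m → ℝ) (p : (Fin m × ℕ) × (Fin m × ℕ)) : Prop :=
  (∀ v, c p.1.1 p.1.2 v ≤ c p.2.1 p.2.2 v) ∨ ∀ v, c p.2.1 p.2.2 v ≤ c p.1.1 p.1.2 v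

theorem Comparable.scale {p : (Fin m × ℕ) × (Fin m × ℕ)} (h : Comparable c p) (v : Var q m) {a : ℝ}
    (ha : 0 < a) : Comparable (fun i j => Function.update (c i j) v (c i j v / a)) p := by
  refine h.imp (fun h u => ?_) fun h u => ?_ <;>
  · by_cases hu : u = v
    · subst hu; simpa using div_le_div_of_nonneg_right (h u) ha.le
    · simpa [hu] using h u

/-- Coefficientwise inequalities survive the addition of coefficients, so comparabilities already
obtained are not lost while another pair is treated. -/
theorem Comparable.merge {p : (Fin m × ℕ) × (Fin m × ℕ)} (h : Comparable c p) (u v w : Var q m) :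
    Comparable (fun i j => Function.update (c i j) u (c i j v + c i j w)) p := by
  refine h.imp (fun h x => ?_) fun h x => ?_ <;>
  · by_cases hx : x = u
    · subst hx; simpa using add_le_add (h v) (h w)
    · simpa [hx] using h x

theorem merge (S : MatchingState k n₀ c f I R σ) {u v w : Var q m} (hu : Free c f I σ u)
    (hv : Free c f I σ v) (hw : Free c f I σ w) :
    MatchingState k n₀ (fun i j => Function.update (c i j) u (c i j v + c i j w))
      (Function.update f u fun x => f v x + f w x) I R σ :=
  S.update le_rfl (Free.below S hu) (fun i j => add_nonneg (S.nonneg i j v) (S.nonneg i j w))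
    ((S.kpos v).add (S.kpos w)) (fun i j h _ => by simp [h]) fun i j hj h => by
      simp [h.apply_eq_zero (hv i j hj h), h.apply_eq_zero (hw i j hj h)]

theorem isRationalSeq_of_merge (S : MatchingState k n₀ c f I R σ) (hkn : k ≤ n₀) {v w : Var q m}
    (hvw : v ≠ w) (hv : Free c f I σ v) (hw : Free c f I σ w)
    (h : ∀ u, u = v ∨ u = w → IsRationalSeq k n₀ fun n =>
      meanCost k n (fun i j => Function.update (c i j) u (c i j v + c i j w))
        (Function.update f u fun x => f v x + f w x)) :
    IsRationalSeq k n₀ fun n => meanCost k n c f := by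
  have hrate := (S.kpos v).add (S.kpos w)
  refine IsRationalSeq.congr (IsRationalSeq.sum hkn {v, w} fun u hu =>
    ((S.kpos u).isRationalSeq_div hkn hrate).mul (h u (by simpa using hu))) fun n hn => ?_
  refine meanCost_split_min (φ := fun i j => c i j v + c i j w) (g := fun x => f v x + f w x)
    {v, w} (Finset.insert_nonempty _ _) ?_
    (fun u => (S.kpos u).2 n (by exact_mod_cast hkn.trans hn)) (fun i j _ => ?_) ?_
  · simp only [Finset.mem_insert, Finset.mem_singleton]
    rintro u (rfl | rfl)
    exacts [(Free.below S hv).mono hn, (Free.below S hw).mono hn]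
  · rw [Finset.sum_pair hvw]
  · rw [Finset.sum_pair hvw]

/-- By case distinctions one may assume that a given pair of entries is comparable. -/
theorem isRationalSeq_of_comparable_insert (hkn : k ≤ n₀)
    (Q : Finset ((Fin m × ℕ) × (Fin m × ℕ))) {p : (Fin m × ℕ) × (Fin m × ℕ)}
    (hp₁ : p.1.2 ∈ I.image σ) (hp₂ : p.2.2 ∈ I.image σ)
    (H : ∀ (c : Fin m → ℕ → Var q m → ℝ) (f : Var q m → ℝ → ℝ), MatchingState k n₀ c f I R σ →
      Comparable c p → (∀ p' ∈ Q, Comparable c p') → IsRationalSeq k n₀ fun n => meanCost k n c f)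
    (S : MatchingState k n₀ c f I R σ) (hQ : ∀ p' ∈ Q, Comparable c p') :
    IsRationalSeq k n₀ fun n => meanCost k n c f := by
  classical
  -- The induction is on the number of variables whose coefficients in the two entries differ.
  induction hN : ((lowVars q m n₀).filter fun v => c p.1.1 p.1.2 v ≠ c p.2.1 p.2.2 v).card
    using Nat.strong_induction_on generalizing c f with
  | _ N ih =>
    by_cases hcomp : Comparable c p
    · exact H c f S hcomp hQ
    obtain ⟨⟨v, hv⟩, w, hw⟩ : (∃ v, c p.2.1 p.2.2 v < c p.1.1 p.1.2 v) ∧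
        ∃ w, c p.1.1 p.1.2 w < c p.2.1 p.2.2 w := by
      unfold Comparable at hcomp
      push Not at hcomp
      exact hcomp
    have hvw : v ≠ w := by rintro rfl; exact lt_asymm hv hw
    have hfv : Free c f I σ v :=
      free_of_ne_zero hp₁ ((S.nonneg _ _ v).trans_lt hv).ne'
    have ha := sub_pos.2 hv
    have hb := sub_pos.2 hw
    set a := c p.1.1 p.1.2 v - c p.2.1 p.2.2 v
    set b := c p.2.1 p.2.2 w - c p.1.1 p.1.2 w
    refine S.isRationalSeq_of_scale hkn hfv ha ?_
    have S₁ := S.scale hfv ha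
    have hQ₁ := fun p' hp' => (hQ p' hp').scale v ha
    set c₁ : Fin m → ℕ → Var q m → ℝ := fun i j => Function.update (c i j) v (c i j v / a) with hc₁
    set f₁ : Var q m → ℝ → ℝ := Function.update f v fun x => f v x / a
    have hc₁v : ∀ i j, c₁ i j v = c i j v / a := fun i j => Function.update_self _ _ _
    have hc₁o : ∀ i j u, u ≠ v → c₁ i j u = c i j u := fun i j u hu => Function.update_of_ne hu _ _
    have hfw₁ : Free c₁ f₁ I σ w := free_of_ne_zero (i := p.2.1) hp₂ (by
      rw [hc₁o _ _ w hvw.symm]; exact ((S.nonneg _ _ w).trans_lt hw).ne')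
    refine S₁.isRationalSeq_of_scale hkn hfw₁ hb ?_
    have S₂ := S₁.scale hfw₁ hb
    have hQ₂ := fun p' hp' => (hQ₁ p' hp').scale w hb
    set c₂ : Fin m → ℕ → Var q m → ℝ := fun i j => Function.update (c₁ i j) w (c₁ i j w / b) with hc₂
    set f₂ : Var q m → ℝ → ℝ := Function.update f₁ w fun x => f₁ w x / b
    have hc₂w : ∀ i j, c₂ i j w = c i j w / b := fun i j => by
      rw [hc₂]; simp only [Function.update_self]; rw [hc₁o i j w hvw.symm]
    have hc₂v : ∀ i j, c₂ i j v = c i j v / a := fun i j => by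
      rw [hc₂]; simp only [Function.update_of_ne hvw]; rw [hc₁v]
    have hc₂o : ∀ i j u, u ≠ v → u ≠ w → c₂ i j u = c i j u := fun i j u huv huw => by
      rw [hc₂]; simp only [Function.update_of_ne huw]; rw [hc₁o i j u huv]
    have hfw₂ : Free c₂ f₂ I σ w := free_of_ne_zero (i := p.2.1) hp₂ (by
      rw [hc₂w]; exact (div_pos ((S.nonneg _ _ w).trans_lt hw) hb).ne')
    have hfv₂ : Free c₂ f₂ I σ v := free_of_ne_zero (i := p.1.1) hp₁ (by
      rw [hc₂v]; exact (div_pos ((S.nonneg _ _ v).trans_lt hv) ha).ne')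
    -- After scaling by `a` and `b`, the first entry exceeds the second by `1` in `v` and falls
    -- short by `1` in `w`. The summed coefficients agree, so whichever of `v`, `w` is smaller no
    -- longer distinguishes the entries.
    have hdiff : c₂ p.1.1 p.1.2 v + c₂ p.1.1 p.1.2 w = c₂ p.2.1 p.2.2 v + c₂ p.2.1 p.2.2 w := by
      have e1 : c p.1.1 p.1.2 v / a - c p.2.1 p.2.2 v / a = 1 := by
        rw [← sub_div]; exact div_self ha.ne'
      have e2 : c p.2.1 p.2.2 w / b - c p.1.1 p.1.2 w / b = 1 := by
        rw [← sub_div]; exact div_self hb.ne'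
      rw [hc₂v, hc₂v, hc₂w, hc₂w]
      linarith
    refine S₂.isRationalSeq_of_merge hkn hvw hfv₂ hfw₂ fun u hu => ?_
    have hfu₂ : Free c₂ f₂ I σ u := by
      rcases hu with rfl | rfl
      exacts [hfv₂, hfw₂]
    have hcu : c p.1.1 p.1.2 u ≠ c p.2.1 p.2.2 u := by
      rcases hu with rfl | rfl
      exacts [hv.ne', hw.ne]
    refine ih _ ?_ (S₂.merge hfu₂ hfv₂ hfw₂) (fun p' hp' => (hQ₂ p' hp').merge u v w) rfl
    rw [← hN]
    refine Finset.card_lt_card ⟨?_, ?_⟩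
    · intro x hx
      rw [Finset.mem_filter] at hx ⊢
      refine ⟨hx.1, ?_⟩
      have hxu : x ≠ u := by
        rintro rfl
        exact hx.2 (by simpa using hdiff)
      have hx2 := hx.2
      simp only [Function.update_of_ne hxu] at hx2
      by_cases hxv : x = v
      · subst hxv; exact hv.ne'
      · by_cases hxw : x = w
        · subst hxw; exact hw.ne
        · rwa [hc₂o _ _ _ hxv hxw, hc₂o _ _ _ hxv hxw] at hx2
    · intro h
      have := h (Finset.mem_filter.2 ⟨Free.mem_lowVars S₂ hfu₂, hcu⟩)
      exact (Finset.mem_filter.1 this).2 (by simpa using hdiff)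

theorem isRationalSeq_of_comparable (hkn : k ≤ n₀) (Q : Finset ((Fin m × ℕ) × (Fin m × ℕ)))
    (hQI : ∀ p ∈ Q, p.1.2 ∈ I.image σ ∧ p.2.2 ∈ I.image σ)
    (H : ∀ (c : Fin m → ℕ → Var q m → ℝ) (f : Var q m → ℝ → ℝ), MatchingState k n₀ c f I R σ →
      (∀ p ∈ Q, Comparable c p) → IsRationalSeq k n₀ fun n => meanCost k n c f)
    (S : MatchingState k n₀ c f I R σ) : IsRationalSeq k n₀ fun n => meanCost k n c f := by
  classical
  induction Q using Finset.induction_on generalizing c f with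
  | empty => exact H c f S (by simp)
  | insert p Q hp ih =>
    refine ih (fun p' hp' => hQI p' (Finset.mem_insert_of_mem hp')) (fun c f S hQ => ?_) S
    have hpI := hQI p (Finset.mem_insert_self _ _)
    refine isRationalSeq_of_comparable_insert hkn Q hpI.1 hpI.2 (fun c f S hc hQ => ?_) S hQ
    refine H c f S fun p' hp' => ?_
    rcases Finset.mem_insert.1 hp' with rfl | h
    exacts [hc, hQ p' h]

theorem isRationalSeq_of_succ (hkm : k ≤ m) (hkn : k ≤ n₀) (hI : I.card < k)
    (hreach : RationalAt q m k I.card (R.card + 1)) (haug : RationalAt q m k (I.card + 1) 0)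
    (S : MatchingState k n₀ c f I R σ) : IsRationalSeq k n₀ fun n => meanCost k n c f := by
  classical
  let N : Finset (Fin m × ℕ) := Rᶜ ×ˢ R.image σ
  refine isRationalSeq_of_comparable hkn (N ×ˢ N) ?_ (fun c f S hQ => ?_) S
  · rintro ⟨e, e'⟩ hp
    simp only [N, Finset.mem_product] at hp
    exact ⟨Finset.image_subset_image S.subset hp.1.2, Finset.image_subset_image S.subset hp.2.2⟩
  · by_cases hN : N.Nonempty
    -- With all pairs comparable, a minimal entry is least.
    · obtain ⟨⟨a, b⟩, hab, hmin⟩ := Finset.exists_minimalFor (fun e : Fin m × ℕ => c e.1 e.2) N hN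
      have hab' : a ∉ R ∧ b ∈ R.image σ := by simpa [N] using hab
      refine isRationalSeq_of_isLeast hkm hkn hI hreach haug hab'.1 hab'.2 S fun i j hi hj => ?_
      have hij : (i, j) ∈ N := Finset.mem_product.2 ⟨Finset.mem_compl.2 hi, hj⟩
      rcases hQ ((a, b), (i, j)) (Finset.mem_product.2 ⟨hab, hij⟩) with h | h
      · exact h
      · exact fun v => hmin hij h v
    · by_cases hzero : ∃ i j, i ∉ R ∧ j ∉ (I \ R).image σ ∧ c i j = 0
      · obtain ⟨i, j, hi, hj, h0⟩ := hzero
        exact S.isRationalSeq_of_zero hkn hreach haug hi hj h0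
      push Not at hzero
      refine S.isRationalSeq_of_steppable (O := ∅) ⟨hzero, by simp, fun i j hi hj => ?_⟩ hkm hkn hI
        hreach haug (by simp)
      exact absurd ⟨(i, j), Finset.mem_product.2 ⟨Finset.mem_compl.2 hi, hj⟩⟩ hN

/-- In every state the mean cost is a rational function of `n` with real poles less than `k`. -/
theorem isRationalSeq (hkm : k ≤ m) (hkn : k ≤ n₀) (S : MatchingState k n₀ c f I R σ) :
    IsRationalSeq k n₀ fun n => meanCost k n c f := by
  -- The outer induction enlarges the matching, the inner one the set of reached rows. Using `m + 1
  -- - b` makes the inner base case impossible, as `b ≤ m`.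
  have key : ∀ x a, k - a = x → ∀ y b, m + 1 - b = y → RationalAt q m k a b := by
    intro x
    induction x with
    | zero =>
      rintro a ha y b - n₀ c f I R σ hkn rfl hR S
      refine (isRationalSeq_const (k := k) (n₀ := n₀) le_rfl).congr fun n hn => ?_
      rw [S.meanCost_eq_zero hn (by omega), ENNReal.ofReal_zero]
    | succ x ihx =>
      intro a ha y
      induction y with
      | zero =>
        rintro b hb n₀ c f I R σ hkn hI rfl S
        have := Finset.card_le_univ R
        rw [Fintype.card_fin] at this
        omega
      | succ y ihy =>
        rintro b hb n₀ c f I R σ hkn rfl rfl S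
        exact isRationalSeq_of_succ hkm hkn (by omega) (ihy _ (by omega))
          (ihx _ (by omega) _ _ rfl) S
  exact key _ _ rfl _ _ rfl n₀ c f I R σ hkn rfl rfl S

end MatchingState

end Recursion

/-! ### Optimal covers, Hall's theorem and restriction to the first columns. -/

section Cover

variable {m n n₀ : ℕ}

/-- The columns of an optimal cover can be matched by independent zeros. -/
theorem IsOptimalCover.exists_matching {Z : Set (Fin m × Fin n)} {R : Finset (Fin m)}
    {C : Finset (Fin n)} (h : IsOptimalCover Z R C) :
    ∃ g : C → Fin m, Function.Injective g ∧ ∀ j : C, (g j, (j : Fin n)) ∈ Z := by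
  classical
  let t : C → Finset (Fin m) := fun j => Finset.univ.filter fun i => (i, (j : Fin n)) ∈ Z ∧ i ∉ R
  -- Hall's condition: if the columns in `A` had fewer than `|A|` zero rows outside `R`, replacing
  -- `A` by those rows would give a smaller cover.
  have hall : ∀ A : Finset C, A.card ≤ (A.biUnion t).card := by
    intro A
    have hA : A.map ⟨Subtype.val, Subtype.val_injective⟩ ⊆ C := by
      intro j hj
      obtain ⟨a, -, rfl⟩ := Finset.mem_map.1 hj
      exact a.2
    have hcov : IsCover Z (R ∪ A.biUnion t) (C \ A.map ⟨Subtype.val, Subtype.val_injective⟩) := by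
      rintro ⟨i, j⟩ hij
      by_cases hi : i ∈ R
      · exact Or.inl (Finset.mem_union_left _ hi)
      · have hj : j ∈ C := (h.1 (i, j) hij).resolve_left hi
        by_cases hjA : (⟨j, hj⟩ : C) ∈ A
        · exact Or.inl (Finset.mem_union_right _
            (Finset.mem_biUnion.2 ⟨⟨j, hj⟩, hjA, by simp [t, hij, hi]⟩))
        · refine Or.inr (Finset.mem_sdiff.2 ⟨hj, fun hmem => hjA ?_⟩)
          obtain ⟨a, ha, rfl⟩ := Finset.mem_map.1 hmem
          exact ha
    have h1 := h.2 _ _ hcov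
    have h2 := Finset.card_union_le R (A.biUnion t)
    have h3 := Finset.card_le_card hA
    rw [Finset.card_sdiff_of_subset hA] at h1
    rw [Finset.card_map] at h1 h3
    omega
  obtain ⟨g, hg, hgt⟩ := (Finset.all_card_le_biUnion_card_iff_exists_injective t).1 hall
  exact ⟨g, hg, fun j => (Finset.mem_filter.1 (hgt j)).2.1⟩

variable {Z₀ : Set (Fin m × Fin n₀)} {Z : Set (Fin m × Fin n)} {h : n₀ ≤ n}

theorem IsCover.restrict (hZ : ∀ i j, (i, j) ∈ Z₀ → (i, Fin.castLE h j) ∈ Z)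
    {R : Finset (Fin m)} {C : Finset (Fin n)} (hc : IsCover Z R C) :
    IsCover Z₀ R (Finset.univ.filter fun j => Fin.castLE h j ∈ C) := by
  rintro ⟨i, j⟩ hij
  simpa using hc _ (hZ i j hij)

theorem IsCover.extend (hZ : ∀ i j, (i, j) ∈ Z → ∃ j₀, Fin.castLE h j₀ = j ∧ (i, j₀) ∈ Z₀)
    {R : Finset (Fin m)} {C : Finset (Fin n₀)} (hc : IsCover Z₀ R C) :
    IsCover Z R (C.map (Fin.castLEEmb h)) := by
  rintro ⟨i, j⟩ hij
  obtain ⟨j₀, rfl, hj₀⟩ := hZ i j hij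
  simpa using hc _ hj₀

theorem card_filter_castLE_le (C : Finset (Fin n)) :
    (Finset.univ.filter fun j : Fin n₀ => Fin.castLE h j ∈ C).card ≤ C.card :=
  Finset.card_le_card_of_injOn (Fin.castLE h) (fun j hj => by simpa using hj)
    (Fin.castLE_injective h).injOn

/-- All zeros lie in the first `n₀` columns, so covers pass between the two sizes without growing,
and optimality is preserved. -/
theorem IsOptimalCover.restrict (hZ : ∀ i j, (i, j) ∈ Z₀ → (i, Fin.castLE h j) ∈ Z)
    (hZ' : ∀ i j, (i, j) ∈ Z → ∃ j₀, Fin.castLE h j₀ = j ∧ (i, j₀) ∈ Z₀)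
    {R : Finset (Fin m)} {C : Finset (Fin n)} (hc : IsOptimalCover Z R C) :
    IsOptimalCover Z₀ R (Finset.univ.filter fun j => Fin.castLE h j ∈ C) := by
  refine ⟨hc.1.restrict hZ, fun R' C' hc' => ?_⟩
  have h1 := hc.2 _ _ (hc'.extend hZ')
  have h2 := card_filter_castLE_le (h := h) C
  rw [Finset.card_map] at h1
  omega

theorem IsOptimalCover.extend (hZ : ∀ i j, (i, j) ∈ Z₀ → (i, Fin.castLE h j) ∈ Z)
    (hZ' : ∀ i j, (i, j) ∈ Z → ∃ j₀, Fin.castLE h j₀ = j ∧ (i, j₀) ∈ Z₀)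
    {R : Finset (Fin m)} {C : Finset (Fin n₀)} (hc : IsOptimalCover Z₀ R C) :
    IsOptimalCover Z R (C.map (Fin.castLEEmb h)) := by
  refine ⟨hc.1.extend hZ', fun R' C' hc' => ?_⟩
  have h1 := hc.2 _ _ (hc'.restrict hZ)
  have h2 := card_filter_castLE_le (h := h) C'
  rw [Finset.card_map]
  omega

end Cover

/-! ### What well-behavedness says about the zeros. -/

section Sequence

variable {k m n₀ : ℕ} {Ω : ℕ → Type*} [∀ n, MeasurableSpace (Ω n)] {μ : ∀ n, Measure (Ω n)}

namespace RAPSequence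

theorem mem_zeros_castLE_iff (S : RAPSequence k m n₀ μ) {n : ℕ} (h : n₀ ≤ n) (i : Fin m)
    (j : Fin n₀) : (i, Fin.castLE h j) ∈ (S.P n h).zeros ↔ (i, j) ∈ (S.P n₀ le_rfl).zeros := by
  have key : ∀ {n : ℕ} (P : ExponentialRAP k m n (μ n)) (i : Fin m) (j : Fin n),
      (i, j) ∈ P.zeros ↔ ∀ l, P.coeffAt i j l = 0 := by
    intro n P i j
    constructor
    · intro hz l
      unfold ExponentialRAP.coeffAt
      split_ifs with hl
      exacts [hz ⟨l, hl⟩, rfl]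
    · intro hz l
      simpa [ExponentialRAP.coeffAt] using hz l
  rw [key, key]
  simp only [S.coeff_eq n h]

theorem exists_of_mem_zeros (S : RAPSequence k m n₀ μ) {n : ℕ} (h : n₀ ≤ n) (i : Fin m) (j : Fin n)
    (hij : (i, j) ∈ (S.P n h).zeros) :
    ∃ j₀, Fin.castLE h j₀ = j ∧ (i, j₀) ∈ (S.P n₀ le_rfl).zeros := by
  rcases lt_or_ge (j : ℕ) n₀ with hj | hj
  · exact ⟨⟨j, hj⟩, rfl, (S.mem_zeros_castLE_iff h i ⟨j, hj⟩).1 hij⟩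
  · obtain ⟨l, -, hl, -⟩ := S.standard_beyond n h i j hj
    have : (S.P n h).coeff i j l = 0 := hij l
    rw [this] at hl
    exact absurd hl zero_ne_one

/-- The columns with nonzero nonstandard entries can be matched by independent zeros. -/
theorem WellBehaved.exists_matching {S : RAPSequence k m n₀ μ} (hS : S.WellBehaved) :
    ∃ (C : Finset (Fin n₀)) (g : C → Fin m), Function.Injective g ∧
      (∀ j : C, (g j, (j : Fin n₀)) ∈ (S.P n₀ le_rfl).zeros) ∧
      ∀ n (h : n₀ ≤ n) (i : Fin m) (j : Fin n₀), j ∉ C →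
        (i, Fin.castLE h j) ∈ (S.P n h).zeros ∨
          (S.P n h).IsStandardPosition i (Fin.castLE h j) := by
  -- The zeros do not depend on `n`. A column-maximal cover found for one `n`, restricted to the
  -- first `n₀` columns, therefore contains the nonstandard columns for every other `n`. If there
  -- are none at all, `C = ∅` suffices.
  by_cases hex : ∃ n, ∃ h : n₀ ≤ n, ∃ (i : Fin m) (j : Fin n₀),
      (i, Fin.castLE h j) ∉ (S.P n h).zeros ∧
        ¬ (S.P n h).IsStandardPosition i (Fin.castLE h j)
  · obtain ⟨n, h, i, j, hz, hs⟩ := hex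
    obtain ⟨R, C, hRC, -⟩ := hS.nonstandard_covered n h i _ hz hs
    have t1 : ∀ {n} (h : n₀ ≤ n) i j, (i, j) ∈ (S.P n₀ le_rfl).zeros →
        (i, Fin.castLE h j) ∈ (S.P n h).zeros := fun h i j => (S.mem_zeros_castLE_iff h i j).2
    have hopt := hRC.1.restrict (h := h) (t1 h) (S.exists_of_mem_zeros h)
    obtain ⟨g, hg, hgz⟩ := hopt.exists_matching
    refine ⟨_, g, hg, hgz, fun n' h' i' j' hj' => ?_⟩
    by_contra! hcon
    obtain ⟨R', C', hRC', hjC'⟩ := hS.nonstandard_covered n' h' i' _ hcon.1 hcon.2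
    have hopt' := (hRC'.1.restrict (h := h') (t1 h') (S.exists_of_mem_zeros h')).extend (h := h)
      (t1 h) (S.exists_of_mem_zeros h)
    have := hRC.2 _ _ hopt' (Finset.mem_map_of_mem (Fin.castLEEmb h) (a := j') (by simpa using hjC'))
    exact hj' (by simpa using this)
  · push Not at hex
    refine ⟨∅, fun j => absurd j.2 (Finset.notMem_empty _),
      fun j => absurd j.2 (Finset.notMem_empty _),
      fun j => absurd j.2 (Finset.notMem_empty _), fun n h i j _ => ?_⟩
    by_cases hz : (i, Fin.castLE h j) ∈ (S.P n h).zeros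
    exacts [Or.inl hz, Or.inr (hex n h i j hz)]

end RAPSequence

end Sequence

/-! ### Passing to the joint law and discarding variables. -/

section Law

/-- Only the variables selected by `ψ` matter, and by independence their joint law is a product. -/
theorem lintegral_comp_expPi {Ω ι κ : Type*} [Fintype κ] [MeasurableSpace Ω]
    {μ : Measure Ω} [IsProbabilityMeasure μ] {X : ι → Ω → ℝ} (hX : iIndepFun X μ) {r : ι → ℝ}
    (hlaw : ∀ l, HasLaw (X l) (expLaw (r l)) μ) {ψ : κ → ι} (hψ : Function.Injective ψ)
    {G : (κ → ℝ) → ℝ≥0∞} (hG : Measurable G) :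
    ∫⁻ ω, G (fun v => X (ψ v) ω) ∂μ = ∫⁻ z, G z ∂expPi (fun v => r (ψ v)) := by
  have h1 := (iIndepFun_iff_map_fun_eq_pi_map (fun v => (hlaw (ψ v)).aemeasurable)).1
    (hX.precomp hψ)
  simp only [(hlaw _).map_eq] at h1
  rw [expPi, ← h1, lintegral_map' hG.aemeasurable
    (aemeasurable_pi_lambda _ fun v => (hlaw (ψ v)).aemeasurable)]

theorem lintegral_expPi_restrict {δ : Type*} [Fintype δ] (r : δ → ℝ) (p : δ → Prop)
    [DecidablePred p] {G : ({v // p v} → ℝ) → ℝ≥0∞} (hG : Measurable G) :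
    ∫⁻ y, G (fun v => y v) ∂expPi r = ∫⁻ z, G z ∂expPi (fun v : {v // p v} => r v) := by
  refine lintegral_comp_expPi (μ := expPi r) (X := fun v y => y v) (r := r) ?_ (fun v => ?_)
    Subtype.val_injective hG
  · exact iIndepFun_pi (X := fun _ x => x) (μ := fun v => expLaw (r v)) fun v => aemeasurable_id
  · exact (measurePreserving_eval (fun v => expLaw (r v)) v).hasLaw

end Law

/-! ### The initial state attached to a well-behaved sequence. -/

section Initial

variable {k m n₀ : ℕ} {Ω : ℕ → Type*} [∀ n, MeasurableSpace (Ω n)] {μ : ∀ n, Measure (Ω n)}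

namespace RAPSequence

open Classical in
/-- The linear forms of the sequence: in the columns in `C` those of `S`, elsewhere zero or a
variable belonging to the position. -/
noncomputable def forms (S : RAPSequence k m n₀ μ) (C : Finset (Fin n₀)) (i : Fin m) (j : ℕ) :
    Var (S.P n₀ le_rfl).p m → ℝ :=
  if h : j < n₀ then
    if (⟨j, h⟩ : Fin n₀) ∈ C then
      Sum.elim (fun l => (((S.P n₀ le_rfl).coeff i ⟨j, h⟩ l : ℚ) : ℝ)) 0
    else if (i, (⟨j, h⟩ : Fin n₀)) ∈ (S.P n₀ le_rfl).zeros then 0 else Pi.single (Sum.inr (i, j)) 1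
  else Pi.single (Sum.inr (i, j)) 1

open Classical in
/-- The intensities as functions of the number of columns. -/
noncomputable def rates (S : RAPSequence k m n₀ μ) (hS : S.WellBehaved) :
    Var (S.P n₀ le_rfl).p m → ℝ → ℝ :=
  -- Rate `1` for variables that do not occur, so that every rate is `k`-positive.
  Sum.elim (fun l => if h : ∃ i j, (S.P n₀ le_rfl).coeffAt i j l ≠ 0 then
    (hS.intensity_linear l h).choose else fun _ => 1) fun _ _ => 1

variable {S : RAPSequence k m n₀ μ} {C : Finset (Fin n₀)} {i : Fin m}

theorem forms_of_mem {j : Fin n₀} (hj : j ∈ C) :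
    S.forms C i j = Sum.elim (fun l => (((S.P n₀ le_rfl).coeff i j l : ℚ) : ℝ)) 0 := by
  simp [forms, hj]

theorem forms_of_zero {j : Fin n₀} (hj : j ∉ C) (hz : (i, j) ∈ (S.P n₀ le_rfl).zeros) :
    S.forms C i j = 0 := by
  simp [forms, hj, hz]

theorem forms_of_ne_zero {j : ℕ} (hj : ∀ h : j < n₀, (⟨j, h⟩ : Fin n₀) ∉ C ∧
    (i, (⟨j, h⟩ : Fin n₀)) ∉ (S.P n₀ le_rfl).zeros) :
    S.forms C i j = Pi.single (Sum.inr (i, j)) 1 := by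
  unfold forms
  split_ifs with h h1 h2
  · exact absurd h1 (hj h).1
  · exact absurd h2 (hj h).2
  · rfl
  · rfl

theorem forms_eq_zero_of_zero {j : Fin n₀} (hz : (i, j) ∈ (S.P n₀ le_rfl).zeros) :
    S.forms C i j = 0 := by
  by_cases hj : j ∈ C
  · rw [forms_of_mem hj]
    ext (l | l)
    · have : (S.P n₀ le_rfl).coeff i j l = 0 := hz l
      simp [this]
    · rfl
  · exact forms_of_zero hj hz

theorem forms_inr_eq_zero {i' : Fin m} {j' j : ℕ} (hne : (i', j') ≠ (i, j)) :
    S.forms C i' j' (Sum.inr (i, j)) = 0 := by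
  have : (Sum.inr (i, j) : Var (S.P n₀ le_rfl).p m) ≠ Sum.inr (i', j') := by
    intro e
    exact hne (Sum.inr.inj e).symm
  unfold forms
  split_ifs <;> simp [Pi.single_eq_of_ne this]

theorem forms_nonneg (j : ℕ) (v) : 0 ≤ S.forms C i j v := by
  unfold forms
  split_ifs
  · rcases v with l | l
    · rw [Sum.elim_inl]
      exact Rat.cast_nonneg.2 ((S.P n₀ le_rfl).coeff i _ l).2
    · simp
  · simp
  all_goals
    rw [Pi.single_apply]
    split_ifs <;> norm_num

theorem isStd_forms (hS : S.WellBehaved) {j : ℕ} (hj : ∀ h : j < n₀, (⟨j, h⟩ : Fin n₀) ∉ C ∧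
    (i, (⟨j, h⟩ : Fin n₀)) ∉ (S.P n₀ le_rfl).zeros) : IsStd (S.forms C) (S.rates hS) i j :=
  ⟨forms_of_ne_zero hj, fun _ => rfl, fun _ _ hne => forms_inr_eq_zero hne⟩

/-- The matched columns are exactly those of `C`, and with `R = ∅` the matching itself serves as the
rearrangement for every unmatched column. -/
theorem matchingState (hS : S.WellBehaved) {g : C → Fin m} (hg : Function.Injective g)
    (hgz : ∀ j : C, (g j, (j : Fin n₀)) ∈ (S.P n₀ le_rfl).zeros) :
    ∃ I σ, MatchingState k n₀ (S.forms C) (S.rates hS) I ∅ σ := by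
  classical
  let σ : Fin m → ℕ := Function.extend g (fun j => ((j : Fin n₀) : ℕ)) fun _ => 0
  have hσ : ∀ j, σ (g j) = ((j : Fin n₀) : ℕ) := fun j => hg.extend_apply _ _ _
  let I : Finset (Fin m) := Finset.univ.image g
  have hI : ∀ a ∈ I, ∃ j, g j = a := fun a ha => by simpa [I] using ha
  have hinj : Set.InjOn σ I := by
    intro a ha b hb hab
    obtain ⟨j, rfl⟩ := hI a ha
    obtain ⟨j', rfl⟩ := hI b hb
    rw [hσ, hσ] at hab
    rw [Subtype.ext (Fin.ext hab)]
  have hzero : ∀ a ∈ I, S.forms C a (σ a) = 0 := by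
    intro a ha
    obtain ⟨j, rfl⟩ := hI a ha
    rw [hσ]
    exact forms_eq_zero_of_zero (hgz j)
  refine ⟨I, σ, fun i j v => forms_nonneg j v, ?_, Finset.empty_subset _, hinj, hzero, ?_, ?_, ?_⟩
  · rintro (l | l)
    · simp only [rates, Sum.elim_inl]
      split_ifs with h
      · exact (hS.intensity_linear l h).choose_spec.1
      · exact isKPositive_one
    · exact isKPositive_one
  · intro i j hj
    by_cases hz : ∃ h : j < n₀, (i, (⟨j, h⟩ : Fin n₀)) ∈ (S.P n₀ le_rfl).zeros
    · obtain ⟨h, hz⟩ := hz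
      exact Or.inl (forms_eq_zero_of_zero hz)
    · refine Or.inr (isStd_forms hS fun h => ⟨fun hC => hj ?_, fun hz' => hz ⟨h, hz'⟩⟩)
      exact Finset.mem_image.2 ⟨g ⟨_, hC⟩, by simp [I], hσ _⟩
  · intro i j hj
    exact isStd_forms hS fun h => absurd h (not_lt.2 hj)
  · intro j hj
    rw [Finset.sdiff_empty] at hj
    exact ⟨σ, hinj, fun _ _ => rfl, hzero, fun a ha e => hj (Finset.mem_image.2 ⟨a, ha, e⟩),
      fun a ha => Or.inr (Finset.mem_image_of_mem _ ha)⟩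

theorem coeff_castLE (S : RAPSequence k m n₀ μ) {n : ℕ} (h : n₀ ≤ n) (i : Fin m) (j : Fin n₀)
    {l : ℕ} (hl : l < (S.P n h).p) (hl₀ : l < (S.P n₀ le_rfl).p) :
    (S.P n h).coeff i (Fin.castLE h j) ⟨l, hl⟩ = (S.P n₀ le_rfl).coeff i j ⟨l, hl₀⟩ := by
  have := S.coeff_eq n h i j l
  simpa [ExponentialRAP.coeffAt, hl, hl₀] using this

theorem lt_of_coeff_ne_zero (S : RAPSequence k m n₀ μ) {n n' : ℕ} (h : n₀ ≤ n) (h' : n₀ ≤ n')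
    {i : Fin m} {j : Fin n₀} {l : Fin (S.P n h).p}
    (hl : (S.P n h).coeff i (Fin.castLE h j) l ≠ 0) : (l : ℕ) < (S.P n' h').p := by
  have h1 := S.coeff_eq n h i j l
  rw [← S.coeff_eq n' h' i j l] at h1
  by_contra hc
  simp [ExponentialRAP.coeffAt, hc] at h1
  exact hl h1

/-- The variables occurring in the matrix of the forms. -/
def Used (S : RAPSequence k m n₀ μ) (C : Finset (Fin n₀)) (n : ℕ)
    (v : FinVar (S.P n₀ le_rfl).p m n) : Prop :=
  ∃ (i : Fin m) (j : Fin n), S.forms C i j v.emb ≠ 0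

/-- Variables of the model are identified with variables of `P n`: a special variable keeps its
index, and the variable of a standard position takes the index given by the standardness in `P n`,
which may vary with `n`. Model variables that do not occur have no counterpart, whence `Used`. -/
theorem exists_index (hS : S.WellBehaved)
    (hC : ∀ n (h : n₀ ≤ n) (i : Fin m) (j : Fin n₀), j ∉ C →
      (i, Fin.castLE h j) ∈ (S.P n h).zeros ∨
        (S.P n h).IsStandardPosition i (Fin.castLE h j)) {n : ℕ} (h : n₀ ≤ n)
    (v : FinVar (S.P n₀ le_rfl).p m n) (hv : S.Used C n v) :
    ∃ l : Fin (S.P n h).p, (S.P n h).intensity l = S.rates hS v.emb n ∧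
      (∀ l', v = Sum.inl l' → (l : ℕ) = l') ∧
      ∀ (i : Fin m) (j : Fin n), (((S.P n h).coeff i j l : ℚ) : ℝ) = S.forms C i j v.emb := by
  obtain ⟨a, b, hab⟩ := hv
  have hdich : ∀ (i : Fin m) (j : Fin n),
      (∃ j₀ ∈ C, Fin.castLE h j₀ = j) ∨ ((i, j) ∈ (S.P n h).zeros ∧ S.forms C i j = 0) ∨
      ((S.P n h).IsStandardPosition i j ∧ S.forms C i j = Pi.single (Sum.inr (i, (j : ℕ))) 1) := by
    intro i j
    rcases lt_or_ge (j : ℕ) n₀ with hj | hj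
    · by_cases hjC : (⟨j, hj⟩ : Fin n₀) ∈ C
      · exact Or.inl ⟨_, hjC, rfl⟩
      · by_cases hz : (i, j) ∈ (S.P n h).zeros
        · have hz₀ := (S.mem_zeros_castLE_iff h i ⟨j, hj⟩).1 hz
          exact Or.inr (Or.inl ⟨hz, forms_of_zero hjC hz₀⟩)
        · refine Or.inr (Or.inr ⟨(hC n h i ⟨j, hj⟩ hjC).resolve_left hz, ?_⟩)
          exact forms_of_ne_zero fun _ =>
            ⟨hjC, fun hz₀ => hz ((S.mem_zeros_castLE_iff h i ⟨j, hj⟩).2 hz₀)⟩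
    · exact Or.inr (Or.inr ⟨S.standard_beyond n h i j hj,
        forms_of_ne_zero fun h' => absurd h' (not_lt.2 hj)⟩)
  rcases v with l | ⟨a', b'⟩
  · -- a variable occurring in the columns in `C`
    have hb : ∃ j₀ ∈ C, Fin.castLE h j₀ = b := by
      rcases hdich a b with hb | hb | hb
      · exact hb
      · exact absurd (by rw [hb.2]; rfl) hab
      · exact absurd (by rw [hb.2]; simp [FinVar.emb]) hab
    obtain ⟨j₀, hj₀, rfl⟩ := hb
    have hne : (S.P n₀ le_rfl).coeff a j₀ l ≠ 0 := by
      intro h0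
      refine hab ?_
      have := forms_of_mem (S := S) (i := a) hj₀
      rw [Fin.val_castLE, this]
      simp [FinVar.emb, h0]
    have hl : (l : ℕ) < (S.P n h).p := S.lt_of_coeff_ne_zero le_rfl h (j := j₀) hne
    refine ⟨⟨l, hl⟩, ?_, fun l' e => congrArg Fin.val (Sum.inl.inj e), fun i j => ?_⟩
    · have hocc : ∃ i j, (S.P n₀ le_rfl).coeffAt i j l ≠ 0 :=
        ⟨a, j₀, by simpa [ExponentialRAP.coeffAt] using hne⟩
      rw [(hS.intensity_linear l hocc).choose_spec.2 n h hl]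
      simp [rates, FinVar.emb, hocc]
    · rcases hdich i j with hj | hj | hj
      · obtain ⟨j₁, hj₁, rfl⟩ := hj
        rw [S.coeff_castLE h i j₁ hl l.2, Fin.val_castLE, forms_of_mem hj₁]
        rfl
      · have : (S.P n h).coeff i j ⟨l, hl⟩ = 0 := hj.1 ⟨l, hl⟩
        rw [hj.2, this]; simp
      · obtain ⟨⟨l₀, -, h1, hother, huniq⟩, hform⟩ := hj
        have hl₀ : (⟨l, hl⟩ : Fin (S.P n h).p) ≠ l₀ := by
          rintro rfl
          have hne' : (S.P n h).coeff a (Fin.castLE h j₀) ⟨l, hl⟩ ≠ 0 := by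
            rw [S.coeff_castLE h a j₀ hl l.2]; exact hne
          obtain ⟨rfl, rfl⟩ := huniq _ _ hne'
          have e := forms_of_mem (S := S) (i := a) hj₀
          rw [Fin.val_castLE] at hform
          have := congrFun (e.symm.trans hform) (Sum.inr (a, (j₀ : ℕ)))
          simp at this
        rw [hother _ hl₀, hform]
        simp [FinVar.emb]
  · have hemb : FinVar.emb (q := (S.P n₀ le_rfl).p) (Sum.inr (a', b')) =
        Sum.inr (a', (b' : ℕ)) := rfl
    rw [hemb] at hab ⊢
    have hpos : a = a' ∧ b = b' := by
      by_contra hne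
      refine hab (forms_inr_eq_zero fun e => hne ?_)
      simpa [Fin.ext_iff] using e
    obtain ⟨rfl, rfl⟩ := hpos
    rcases hdich a b with hb | hb | hb
    · obtain ⟨j₀, hj₀, rfl⟩ := hb
      refine absurd ?_ hab
      have := forms_of_mem (S := S) (i := a) hj₀
      rw [Fin.val_castLE, this]; rfl
    · exact absurd (by rw [hb.2]; rfl) hab
    · obtain ⟨⟨l₀, hint, h1, -, huniq⟩, hform⟩ := hb
      refine ⟨l₀, hint, fun l' e => (Sum.inr_ne_inl e).elim, fun i j => ?_⟩
      by_cases hij : (i, j) = (a, b)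
      · obtain ⟨rfl, rfl⟩ := Prod.mk.inj hij
        rw [h1, hform]; simp
      · rw [forms_inr_eq_zero fun e => hij (by simpa [Fin.ext_iff] using e)]
        have : (S.P n h).coeff i j l₀ = 0 := by
          by_contra hc
          obtain ⟨rfl, rfl⟩ := huniq i j hc
          exact hij rfl
        simp [this]

end RAPSequence

end Initial

/-! ### Transfer to the given probability spaces and conclusion. -/

section Main

variable {k m n₀ : ℕ} {Ω : ℕ → Type*} [∀ n, MeasurableSpace (Ω n)] {μ : ∀ n, Measure (Ω n)}

namespace RAPSequence

variable {S : RAPSequence k m n₀ μ} {C : Finset (Fin n₀)}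

theorem lintegral_cost_eq_meanCost [∀ n, IsProbabilityMeasure (μ n)] (hS : S.WellBehaved)
    (hC : ∀ n (h : n₀ ≤ n) (i : Fin m) (j : Fin n₀), j ∉ C →
      (i, Fin.castLE h j) ∈ (S.P n h).zeros ∨
        (S.P n h).IsStandardPosition i (Fin.castLE h j)) {n : ℕ} (h : n₀ ≤ n) :
    ∫⁻ ω, ENNReal.ofReal ((S.P n h).cost ω) ∂μ n = meanCost k n (S.forms C) (S.rates hS) := by
  classical
  choose! ψ₀ hint hinl hcoeff using exists_index hS hC h
  let ψ : {v // S.Used C n v} → Fin (S.P n h).p := fun v => ψ₀ v.1 v.2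
  have hinj : Function.Injective ψ := by
    -- A shared index would give both model variables the same coefficients everywhere, but no form
    -- contains both a special and a position variable.
    have hmixed : ∀ (l) (e : Fin m × Fin n) (hl : S.Used C n (Sum.inl l))
        (he : S.Used C n (Sum.inr e)), ψ ⟨_, hl⟩ ≠ ψ ⟨_, he⟩ := by
      intro l e hl he heq
      have he' := he
      obtain ⟨a, b, hab⟩ := he'
      have hab' := hab
      rw [← hcoeff (Sum.inr e) he] at hab'
      change (((S.P n h).coeff a b (ψ ⟨_, he⟩) : ℚ) : ℝ) ≠ 0 at hab'
      rw [← heq] at hab'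
      have h2 : (((S.P n h).coeff a b (ψ ⟨_, hl⟩) : ℚ) : ℝ) = _ := hcoeff (Sum.inl l) hl a b
      rw [h2] at hab'
      change S.forms C a b (Sum.inl l) ≠ 0 at hab'
      change S.forms C a b (Sum.inr (e.1, (e.2 : ℕ))) ≠ 0 at hab
      unfold forms at hab hab'
      split_ifs at hab hab' <;> simp at hab hab'
    rintro ⟨v | e, hv⟩ ⟨v' | e', hv'⟩ heq
    · have h1 := hinl (Sum.inl v) hv v rfl
      have h2 := hinl (Sum.inl v') hv' v' rfl
      have h3 : v = v' := Fin.ext (h1.symm.trans ((congrArg Fin.val heq).trans h2))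
      subst h3; rfl
    · exact absurd heq (hmixed v e' hv hv')
    · exact absurd heq.symm (hmixed v' e hv' hv)
    · have hv₁ := hv
      obtain ⟨a, b, hab⟩ := hv₁
      have hpos : (a, (b : ℕ)) = (e.1, (e.2 : ℕ)) := by
        by_contra hne
        exact hab (forms_inr_eq_zero hne)
      have hab' := hab
      rw [← hcoeff (Sum.inr e) hv] at hab'
      change (((S.P n h).coeff a b (ψ ⟨_, hv⟩) : ℚ) : ℝ) ≠ 0 at hab'
      rw [heq] at hab'
      have h2 : (((S.P n h).coeff a b (ψ ⟨_, hv'⟩) : ℚ) : ℝ) = _ := hcoeff (Sum.inr e') hv' a b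
      rw [h2] at hab'
      have hpos' : (a, (b : ℕ)) = (e'.1, (e'.2 : ℕ)) := by
        by_contra hne
        exact hab' (forms_inr_eq_zero hne)
      have : e = e' := by
        have := hpos.symm.trans hpos'
        simp only [Prod.mk.injEq] at this
        exact Prod.ext this.1 (Fin.ext this.2)
      subst this; rfl
  -- Every variable of `P n` with a nonzero coefficient is hit by `ψ`, so no entry loses a summand
  -- in the model.
  have hrange : ∀ (i : Fin m) (j : Fin n) (l : Fin (S.P n h).p), (S.P n h).coeff i j l ≠ 0 →
      ∃ v, ψ v = l := by
    intro i j l hl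
    by_cases hj : ∃ j₀ ∈ C, Fin.castLE h j₀ = j
    · obtain ⟨j₀, hj₀, rfl⟩ := hj
      have hl₀ := S.lt_of_coeff_ne_zero h le_rfl hl
      have hused : S.Used C n (Sum.inl ⟨l, hl₀⟩) := by
        refine ⟨i, Fin.castLE h j₀, ?_⟩
        rw [Fin.val_castLE, forms_of_mem hj₀]
        have := S.coeff_castLE h i j₀ l.2 hl₀
        simp only [FinVar.emb, Sum.map_inl, id, Sum.elim_inl]
        rw [← this]
        simpa using hl
      exact ⟨⟨_, hused⟩, Fin.ext (hinl _ hused _ rfl)⟩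
    · have hnz : (i, j) ∉ (S.P n h).zeros := fun hz => hl (hz l)
      have hform : S.forms C i j = Pi.single (Sum.inr (i, (j : ℕ))) 1 :=
        forms_of_ne_zero fun hj' => ⟨fun hjC => hj ⟨_, hjC, rfl⟩,
          fun hz => hnz ((S.mem_zeros_castLE_iff h i ⟨j, hj'⟩).2 hz)⟩
      have hstd : (S.P n h).IsStandardPosition i j := by
        rcases lt_or_ge (j : ℕ) n₀ with hj' | hj'
        · exact (hC n h i ⟨j, hj'⟩ fun hjC => hj ⟨_, hjC, rfl⟩).resolve_left hnz
        · exact S.standard_beyond n h i j hj'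
      have hused : S.Used C n (Sum.inr (i, j)) := ⟨i, j, by rw [hform]; simp [FinVar.emb]⟩
      obtain ⟨l₀, -, -, hother, -⟩ := hstd
      have h1 : l = l₀ := by by_contra hne; exact hl (hother l hne)
      refine ⟨⟨_, hused⟩, ?_⟩
      rw [h1]
      by_contra hne
      have h2 := hcoeff _ hused i j
      rw [hform, show (S.P n h).coeff i j (ψ₀ _ hused) = 0 from hother _ hne] at h2
      simp [FinVar.emb] at h2
  let G : ({v // S.Used C n v} → ℝ) → ℝ≥0∞ := fun z => ENNReal.ofReal
    (minAssignmentSum k fun i (j : Fin n) => ∑ v, S.forms C i j (FinVar.emb v.1) * z v)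
  have hG : Measurable G := by
    refine (measurable_minAssignmentSum fun i j => ?_).ennreal_ofReal
    fun_prop
  have e1 : ∀ ω, ENNReal.ofReal ((S.P n h).cost ω) = G fun v => (S.P n h).X (ψ v) ω := by
    intro ω
    simp only [G, ExponentialRAP.cost]
    congr 2
    ext i j
    unfold ExponentialRAP.entry
    have : ∀ v : {v // S.Used C n v}, S.forms C i j (FinVar.emb v.1) =
        (((S.P n h).coeff i j (ψ v) : ℚ) : ℝ) := fun v => (hcoeff v.1 v.2 i j).symm
    simp only [this]
    refine (Finset.sum_of_injOn ψ hinj.injOn (fun _ _ => Finset.mem_coe.2 (Finset.mem_univ _))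
      (fun l _ hl => ?_) fun _ _ => rfl).symm
    have h0 : (S.P n h).coeff i j l = 0 := by
      by_contra hc
      obtain ⟨v, rfl⟩ := hrange i j l hc
      exact hl ⟨v, Finset.mem_coe.2 (Finset.mem_univ _), rfl⟩
    simp [h0]
  have e2 : ∀ y : FinVar (S.P n₀ le_rfl).p m n → ℝ,
      ENNReal.ofReal (minAssignmentSum k (formMatrix n (S.forms C) y)) = G fun v => y v := by
    intro y
    simp only [G]
    congr 2
    ext i j
    unfold formMatrix
    refine (Finset.sum_of_injOn Subtype.val Subtype.val_injective.injOn
      (fun _ _ => Finset.mem_coe.2 (Finset.mem_univ _)) (fun v _ hv => ?_) fun _ _ => rfl).symm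
    have h0 : S.forms C i j v.emb = 0 := by
      by_contra hc
      exact hv ⟨⟨v, i, j, hc⟩, Finset.mem_coe.2 (Finset.mem_univ _), rfl⟩
    rw [h0, zero_mul]
  simp only [meanCost, e1, e2]
  rw [lintegral_expPi_restrict _ _ hG, lintegral_comp_expPi (S.P n h).indep
    (r := (S.P n h).intensity) (fun l => by
      rw [expLaw_of_pos ((S.P n h).intensity_pos l)]; exact (S.P n h).hasLaw l) hinj hG]
  congr 2
  ext v
  exact hint v.1 v.2

end RAPSequence

theorem ExponentialRAP.ae_cost_nonneg {n : ℕ} {Ω : Type*} [MeasurableSpace Ω] {μ : Measure Ω}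
    (P : ExponentialRAP k m n μ) : ∀ᵐ ω ∂μ, 0 ≤ P.cost ω := by
  have hX : ∀ᵐ ω ∂μ, ∀ l, 0 ≤ P.X l ω := by
    rw [ae_all_iff]
    intro l
    have := ae_nonneg_expLaw (P.intensity l)
    rw [expLaw_of_pos (P.intensity_pos l), ← (P.hasLaw l).map_eq] at this
    exact ae_of_ae_map (P.hasLaw l).aemeasurable this
  filter_upwards [hX] with ω hω
  refine minAssignmentSum_nonneg fun i j => Finset.sum_nonneg fun l _ => mul_nonneg ?_ (hω l)
  exact Rat.cast_nonneg.2 (P.coeff i j l).2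

theorem ExponentialRAP.aemeasurable_cost {n : ℕ} {Ω : Type*} [MeasurableSpace Ω] {μ : Measure Ω}
    (P : ExponentialRAP k m n μ) : AEMeasurable P.cost μ := by
  have h : Measurable fun x : Fin P.p → ℝ => minAssignmentSum k fun (i : Fin m) (j : Fin n) =>
      ∑ l, ((P.coeff i j l : ℚ) : ℝ) * x l :=
    measurable_minAssignmentSum fun i j => by fun_prop
  exact h.comp_aemeasurable (aemeasurable_pi_lambda (fun ω l => P.X l ω)
    fun l => (P.hasLaw l).aemeasurable)

end Main

theorem theoremT {k m n₀ : ℕ} {Ω : ℕ → Type*} [∀ n, MeasurableSpace (Ω n)]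
    (μ : ∀ n, Measure (Ω n)) [∀ n, IsProbabilityMeasure (μ n)]
    (S : RAPSequence k m n₀ μ) (hS : S.WellBehaved) :
    ∃ f : RatFunc ℝ,
      (∀ z : ℂ, Polynomial.aeval z f.denom = 0 → z.im = 0 ∧ z.re < k) ∧
      ∀ n (h : n₀ ≤ n), Integrable (S.P n h).cost (μ n) ∧
        (S.P n h).expectedCost = f.eval (RingHom.id ℝ) (n : ℝ) := by

  obtain ⟨C, g, hg, hgz, hC⟩ := hS.exists_matching
  obtain ⟨I, σ, hM⟩ := RAPSequence.matchingState hS hg hgz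
  have hkm := (S.P n₀ le_rfl).k_le_m
  have hkn := (S.P n₀ le_rfl).k_le_n
  obtain ⟨p, q, hq, hpq⟩ := hM.isRationalSeq hkm hkn
  have hq0 : q ≠ 0 := by
    rintro rfl
    exact hq.eval_ne_zero le_rfl Polynomial.eval_zero
  -- The reduced denominator divides `q`, so its zeros are among those of `q`.
  have hdvd := RatFunc.denom_div_dvd p q
  refine ⟨algebraMap _ _ p / algebraMap _ _ q, hq.of_dvd hdvd, fun n h => ?_⟩
  obtain ⟨hnonneg, hval⟩ := hpq n h
  beta_reduce at hval
  rw [← RAPSequence.lintegral_cost_eq_meanCost hS hC h] at hval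
  have hae := (S.P n h).ae_cost_nonneg
  have hmeas := (S.P n h).aemeasurable_cost
  refine ⟨⟨hmeas.aestronglyMeasurable, ?_⟩, ?_⟩
  · rw [hasFiniteIntegral_iff_ofReal hae, hval]
    exact ENNReal.ofReal_lt_top
  · have hkn' : (k : ℝ) ≤ n := by exact_mod_cast hkn.trans h
    have hqn := hq.eval_ne_zero hkn'
    have hdn := (hq.of_dvd hdvd).eval_ne_zero hkn'
    rw [ExponentialRAP.expectedCost,
      integral_eq_lintegral_of_nonneg_ae hae hmeas.aestronglyMeasurable, hval,
      ENNReal.toReal_ofReal hnonneg, RatFunc.eval]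
    have hcross := congrArg (Polynomial.eval (n : ℝ)) ((RatFunc.num_mul_eq_mul_denom_iff
      (x := algebraMap (Polynomial ℝ) (RatFunc ℝ) p / algebraMap _ _ q) hq0).2 rfl)
    rw [Polynomial.eval_mul, Polynomial.eval_mul] at hcross
    rw [Polynomial.eval₂_id, Polynomial.eval₂_id, div_eq_div_iff hqn hdn, ← hcross]
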